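/- Let $R\subset\mathbb{R}^d$ ($d\ge 1$) be a finite reduced root system normalized by $|\alpha|^2=2$ for $\alpha\in R$, with reflections $\sigma_\alpha(x)=x-\langle x,\alpha\rangle\alpha$ and positive subsystem $R_+$, and let $\kappa:R\to[0,\infty)$ be invariant under the group generated by the $\sigma_\alpha$. Consider the Dunkl operators $$T_j^\kappa f(x)=\frac{\partial f}{\partial x_j}(x)+\sum_{\alpha\in R_+}\kappa(\alpha)\,\alpha_j\,\frac{f(x)-f(\sigma_\alpha x)}{\langle x,\alpha\rangle},\qquad 1\le j\le d,$$ (difference quotients being extended continuously to the hyperplanes $\langle x,\alpha\rangle=0$), the Dunkl Laplacian $\Delta_\kappa=\sum_{j}(T_j^\kappa)^2$, the operators $\delta_j^\kappa=T_j^\kappa+x_j$, the measure $d\mu_\kappa(x)=\prod_{\alpha\in R_+}|\langle\alpha,x\rangle|^{2\kappa(\alpha)}\,dx$, and the constants $\gamma_\kappa=\sum_{\alpha\in R_+}\kappa(\alpha)$, $c_\kappa=\int_{\mathbb{R}^d} e^{-|x|^2/2}\,d\mu_\kappa(x)$, $m_\kappa=2^{\gamma_\kappa+d/2}c_\kappa^{-1}$.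 Let $\{\varphi_n : n\in\mathbb{N}^d\}$ be a basis of the space of complex polynomials on $\mathbb{R}^d$, with real coefficients and with $\varphi_n$ homogeneous of degree $|n|=n_1+\dots+n_d$, which is orthonormal for the bilinear form $[p,q]_\kappa=(p(T^\kappa)q)(0)$, where $p(T^\kappa)$ is obtained from $p$ by replacing $x_j$ by $T_j^\kappa$. Define the generalized Hermite polynomials and functions by $$H_n^\kappa=2^{|n|}e^{-\Delta_\kappa/4}\varphi_n,\qquad h_n^\kappa(x)=2^{-|n|/2}\sqrt{m_\kappa}\,e^{-|x|^2/2}H_n^\kappa(x),$$ let $\mathcal{D}$ be the complex linear span of the $h_n^\kappa$, and, for $f\in\mathcal{D}$ and $1\le j\le d$, put $$R_j^\kappa f=\sum_{n\in\mathbb{N}^d}(2|n|+2\gamma_\kappa+d)^{-1/2}\,\langle f,h_n^\kappa\rangle\,\delta_j^\kappa h_n^\kappa,\qquad \langle f,g\rangle=\int_{\mathbb{R}^d} f\,\overline{g}\,d\mu_\kappa .$$ Then for every $f\in\mathcal{D}$ this sum has only finitely many nonzero terms, $f$ and $R_j^\kappa f$ belong to $L^2(\mathbb{R}^d,d\mu_\kappa)$,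 and $R_j^\kappa$ extends uniquely to a bounded linear operator from $L^2(\mathbb{R}^d,d\mu_\kappa)$ to itself. This extension has operator norm at most $\sqrt2$; in particular $\|R_j^\kappa f\|_2\le\sqrt2\,\|f\|_2$ for $f\in\mathcal{D}$. -/

import Mathlib

open MeasureTheory

noncomputable section

namespace Dunkl

/-- The reflection `σ_α(x) = x - ⟨x, α⟩ α`, for `α` normalized by `⟨α, α⟩ = 2`. -/
def rootReflection {d : ℕ} (α x : EuclideanSpace ℝ (Fin d)) : EuclideanSpace ℝ (Fin d) :=
  x - (inner ℝ x α) • α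

/-- A (finite, reduced) root system in `ℝ^d`, normalized by `⟨α, α⟩ = 2`. As usual in Dunkl theory
it need neither span nor be crystallographic. -/
structure IsRootSystem {d : ℕ} (R : Finset (EuclideanSpace ℝ (Fin d))) : Prop where
  inner_self : ∀ α ∈ R, inner ℝ α α = (2 : ℝ)
  reduced : ∀ α ∈ R, ∀ c : ℝ, c • α ∈ R → c = 1 ∨ c = -1
  refl_mem : ∀ α ∈ R, ∀ β ∈ R, rootReflection α β ∈ R

/-- `Rp` is a positive subsystem of `R`: the roots on the positive side of some hyperplane
through the origin which contains no root. -/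
def IsPositiveSubsystem {d : ℕ} (R Rp : Finset (EuclideanSpace ℝ (Fin d))) : Prop :=
  ∃ β : EuclideanSpace ℝ (Fin d), (∀ α ∈ R, inner ℝ α β ≠ (0 : ℝ)) ∧
    ∀ α, α ∈ Rp ↔ α ∈ R ∧ (0 : ℝ) < inner ℝ α β

/-- `κ` is a non-negative function on `R`, invariant under the group generated by the reflections
`σ_α`, `α ∈ R` (only the values of `κ` on `R` matter). -/
structure IsMultiplicity {d : ℕ} (R : Finset (EuclideanSpace ℝ (Fin d)))
    (κ : EuclideanSpace ℝ (Fin d) → ℝ) : Prop where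
  nonneg : ∀ α ∈ R, 0 ≤ κ α
  invariant : ∀ α ∈ R, ∀ β ∈ R, κ (rootReflection α β) = κ β

section Operators

variable {d : ℕ} (Rp : Finset (EuclideanSpace ℝ (Fin d))) (κ : EuclideanSpace ℝ (Fin d) → ℝ)

/-- The difference quotient `(f(x) - f(σ_α x)) / ⟨x, α⟩`; on the hyperplane `⟨x, α⟩ = 0` it has, for
a `C¹` function `f` and `⟨α, α⟩ = 2`, the continuous extension given by the derivative of `f` at `x`
in the direction `α`. -/
def diffQuot (α : EuclideanSpace ℝ (Fin d)) (f : EuclideanSpace ℝ (Fin d) → ℂ)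
    (x : EuclideanSpace ℝ (Fin d)) : ℂ :=
  if inner ℝ x α = (0 : ℝ) then fderiv ℝ f x α
  else (f x - f (rootReflection α x)) / ((inner ℝ x α : ℝ) : ℂ)

/-- The Dunkl operator `T_j^κ`. -/
def dunklT (j : Fin d) (f : EuclideanSpace ℝ (Fin d) → ℂ) (x : EuclideanSpace ℝ (Fin d)) : ℂ :=
  fderiv ℝ f x (EuclideanSpace.single j 1)
    + ∑ α ∈ Rp, ((κ α * α j : ℝ) : ℂ) * diffQuot α f x

/-- The Dunkl Laplacian `Δ_κ = ∑_j (T_j^κ)²`. -/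
def dunklLaplacian (f : EuclideanSpace ℝ (Fin d) → ℂ) (x : EuclideanSpace ℝ (Fin d)) : ℂ :=
  ∑ j, dunklT Rp κ j (dunklT Rp κ j f) x

/-- `δ_j^κ = T_j^κ + x_j`. -/
def delta (j : Fin d) (f : EuclideanSpace ℝ (Fin d) → ℂ) (x : EuclideanSpace ℝ (Fin d)) : ℂ :=
  dunklT Rp κ j f x + ((x j : ℝ) : ℂ) * f x

/-- The weight `w_κ(x) = ∏_{α ∈ R_+} |⟨α, x⟩|^{2 κ(α)}`. -/
def weight (x : EuclideanSpace ℝ (Fin d)) : ℝ :=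
  ∏ α ∈ Rp, |(inner ℝ α x : ℝ)| ^ (2 * κ α)

/-- The measure `dμ_κ(x) = w_κ(x) dx`. -/
def mu : Measure (EuclideanSpace ℝ (Fin d)) :=
  volume.withDensity fun x => ENNReal.ofReal (weight Rp κ x)

/-- `γ_κ = ∑_{α ∈ R_+} κ(α)`. -/
def gam : ℝ := ∑ α ∈ Rp, κ α

/-- `c_κ = ∫ e^{-|x|²/2} dμ_κ(x)`. -/
def cConst : ℝ := ∫ x, Real.exp (-‖x‖ ^ 2 / 2) ∂(mu Rp κ)

/-- `m_κ = 2^{γ_κ + d/2} / c_κ`. -/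
def mConst : ℝ := (2 : ℝ) ^ (gam Rp κ + (d : ℝ) / 2) / cConst Rp κ

/-- The function on `ℝ^d` defined by a complex polynomial. -/
def polyFun (p : MvPolynomial (Fin d) ℂ) (x : EuclideanSpace ℝ (Fin d)) : ℂ :=
  MvPolynomial.eval (fun i => ((x i : ℝ) : ℂ)) p

/-- The operator `T^m = (T_1^κ)^{m_1} ⋯ (T_d^κ)^{m_d}` (on polynomials the order of the factors does
not matter, because the Dunkl operators commute). -/
def monomialT (m : Fin d →₀ ℕ) (f : EuclideanSpace ℝ (Fin d) → ℂ) :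
    EuclideanSpace ℝ (Fin d) → ℂ :=
  (List.finRange d).foldr (fun j g => (dunklT Rp κ j)^[m j] g) f

/-- The bilinear form `[p, q]_κ = (p(T) q)(0)`, where `p(T)` is obtained from `p` by replacing `x_j`
by `T_j^κ`. -/
def pairing (p q : MvPolynomial (Fin d) ℂ) : ℂ :=
  ∑ m ∈ p.support, MvPolynomial.coeff m p * monomialT Rp κ m (polyFun q) 0

/-- `φ_n`, `n ∈ ℕ^d`, is an orthonormal basis of the polynomials for `[·,·]_κ` with real
coefficients, `φ_n` being homogeneous of degree `|n| = n_1 + ⋯ + n_d`.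
(Linear independence follows from orthonormality.) -/
structure IsOrthonormalBasis (φ : (Fin d → ℕ) → MvPolynomial (Fin d) ℂ) : Prop where
  homogeneous : ∀ n, (φ n).IsHomogeneous (∑ i, n i)
  real_coeff : ∀ n m, (MvPolynomial.coeff m (φ n)).im = 0
  orthonormal : ∀ n m, pairing Rp κ (φ n) (φ m) = if n = m then 1 else 0
  span_eq_top : Submodule.span ℂ (Set.range φ) = ⊤

/-- `e^{-Δ_κ/4} p` for a polynomial `p`. The exponential series terminates: `Δ_κ` lowers the degree
by two, so the terms with `k > deg p` vanish. -/
def expLaplacian (p : MvPolynomial (Fin d) ℂ) (x : EuclideanSpace ℝ (Fin d)) : ℂ :=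
  ∑ k ∈ Finset.range (p.totalDegree + 1),
    ((-1 / 4 : ℂ) ^ k / (k.factorial : ℂ)) * (dunklLaplacian Rp κ)^[k] (polyFun p) x

variable (φ : (Fin d → ℕ) → MvPolynomial (Fin d) ℂ)

/-- The generalized Hermite polynomial `H_n^κ = 2^{|n|} e^{-Δ_κ/4} φ_n`. -/
def hermiteH (n : Fin d → ℕ) (x : EuclideanSpace ℝ (Fin d)) : ℂ :=
  (2 : ℂ) ^ (∑ i, n i) * expLaplacian Rp κ (φ n) x

/-- The generalized Hermite function `h_n^κ(x) = 2^{-|n|/2} √m_κ e^{-|x|²/2} H_n^κ(x)`. -/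
def hermiteFun (n : Fin d → ℕ) (x : EuclideanSpace ℝ (Fin d)) : ℂ :=
  (((2 : ℝ) ^ (-((∑ i, n i : ℕ) : ℝ) / 2) * Real.sqrt (mConst Rp κ)
      * Real.exp (-‖x‖ ^ 2 / 2) : ℝ) : ℂ) * hermiteH Rp κ φ n x

/-- The space `𝒟`: the complex linear span of the generalized Hermite functions. -/
def hermiteSpan : Submodule ℂ (EuclideanSpace ℝ (Fin d) → ℂ) :=
  Submodule.span ℂ (Set.range (hermiteFun Rp κ φ))

/-- The coefficient `⟨f, h_n^κ⟩ = ∫ f(x) conj(h_n^κ(x)) dμ_κ(x)`. -/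
def hermiteCoeff (f : EuclideanSpace ℝ (Fin d) → ℂ) (n : Fin d → ℕ) : ℂ :=
  ∫ x, f x * (starRingEnd ℂ) (hermiteFun Rp κ φ n x) ∂(mu Rp κ)

/-- The Riesz transform
`R_j^κ f = δ_j^κ L_κ^{-1/2} f = ∑_n (2|n| + 2γ_κ + d)^{-1/2} ⟨f, h_n^κ⟩ δ_j^κ h_n^κ` for `f ∈ 𝒟`
(for such `f` only finitely many terms of the sum are non-zero). -/
def riesz (j : Fin d) (f : EuclideanSpace ℝ (Fin d) → ℂ) (x : EuclideanSpace ℝ (Fin d)) : ℂ :=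
  ∑ᶠ n : Fin d → ℕ,
    (((2 * ((∑ i, n i : ℕ) : ℝ) + 2 * gam Rp κ + (d : ℝ)) ^ (-(1 / 2) : ℝ) : ℝ) : ℂ)
      * hermiteCoeff Rp κ φ f n * delta Rp κ j (hermiteFun Rp κ φ n) x

end Operators

end Dunkl

end

/-!
The Riesz transforms are controlled by an algebra of operators on polynomials. Write `E` for the
Gaussian `e^{-|x|²/2}` and `U p = E · e^{-Δ/4} p ∈ L²(μ_κ)`, so that the Hermite function `h_n` is a
multiple of `U φ_n`.

*Algebra.* On polynomials, `[T_i, x_j] = δ_ij + ∑_α κ(α) α_i α_j σ_α` and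
`T_i σ_β = σ_β (T_i - β_i T_β)`. Hence `T_i T_j x_k - x_k T_i T_j` is symmetric in `i` and `j`, so
that the commutator `[T_i, T_j]` commutes with all `x_k`; as it kills the constants, it vanishes
(`dunklPoly_comm`). It follows that `T_i` and `σ_β` commute with `Δ`, and that `[Δ, x_j] = 2 T_j`,
that is `e^{-Δ/4} x_j = (x_j - T_j / 2) e^{-Δ/4}` (`expPoly_X_mul`).

*Adjunction.* In `L²(e^{-|x|²} μ_κ)` the adjoint of `T_j` is `2 x_j - T_j` (`integral_dunklDiv`).
The logarithmic derivative of the weight is singular, so the weight is first replaced by the smooth,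
reflection invariant weights `∏_α (⟨x, α⟩² + ε)^{κ(α)}`; symmetrizing with the reflections *before*
letting `ε → 0` leaves only bounded factors. Therefore `⟨U (x_j p), U q⟩ = ½ ⟨U p, U (T_j q)⟩`
(`inner_hermiteLp_X_mul`), and iterating this shows that `⟨U p, U q⟩` is a multiple of
`[p, q]_κ` on homogeneous polynomials (`inner_eq_pairing`): the `h_n` are orthonormal.

*The bound.* Since `T_j` commutes with `e^{-Δ/4}`, `δ_j (U p) = U (T_j p)`. By the adjunction,
`∑_j ‖U (T_j p)‖² = 2 ⟨U (∑_j x_j T_j p), U p⟩`, and on homogeneous polynomials of degree `n` the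
operator `∑_j x_j T_j` is `n + ∑_α κ(α) (1 - σ_α)`, where the reflections `σ_α` act isometrically. So
`‖δ_j ∑ a_n h_n‖² ≤ ∑ (2|n| + 4γ_κ) |a_n|² ≤ 2 ∑ (2|n| + 2γ_κ + d) |a_n|²`
(`norm_dunklPoly_sq_le`, `norm_riesz_le`).

*Density.* A function of `L²(μ_κ)` orthogonal to all `E · p` has, after multiplication by `E`, a
vanishing Fourier transform (`denseRange_gaussLp`). So the bounded operator on the span of the `h_n`
extends in exactly one way to `L²(μ_κ)`.
-/

noncomputable section

namespace Dunkl

open MvPolynomial Filter Topology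

variable {d : ℕ}

/-! ### Polynomial functions and difference quotients -/

@[simp] lemma polyFun_C (c : ℂ) (x : EuclideanSpace ℝ (Fin d)) : polyFun (C c) x = c := by
  simp [polyFun]

@[simp] lemma polyFun_X (i : Fin d) (x : EuclideanSpace ℝ (Fin d)) :
    polyFun (X i) x = ((x i : ℝ) : ℂ) := by
  simp [polyFun]

@[simp] lemma polyFun_zero (x : EuclideanSpace ℝ (Fin d)) : polyFun 0 x = 0 := by
  simp [polyFun]

@[simp] lemma polyFun_one (x : EuclideanSpace ℝ (Fin d)) : polyFun 1 x = 1 := by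
  simp [polyFun]

@[simp] lemma polyFun_add (p q : MvPolynomial (Fin d) ℂ) (x : EuclideanSpace ℝ (Fin d)) :
    polyFun (p + q) x = polyFun p x + polyFun q x := by
  simp [polyFun]

@[simp] lemma polyFun_sub (p q : MvPolynomial (Fin d) ℂ) (x : EuclideanSpace ℝ (Fin d)) :
    polyFun (p - q) x = polyFun p x - polyFun q x := by
  simp [polyFun]

@[simp] lemma polyFun_mul (p q : MvPolynomial (Fin d) ℂ) (x : EuclideanSpace ℝ (Fin d)) :
    polyFun (p * q) x = polyFun p x * polyFun q x := by
  simp [polyFun]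

@[simp] lemma polyFun_pow (p : MvPolynomial (Fin d) ℂ) (n : ℕ) (x : EuclideanSpace ℝ (Fin d)) :
    polyFun (p ^ n) x = polyFun p x ^ n := by
  simp [polyFun]

@[simp] lemma polyFun_smul (c : ℂ) (p : MvPolynomial (Fin d) ℂ) (x : EuclideanSpace ℝ (Fin d)) :
    polyFun (c • p) x = c * polyFun p x := by
  simp [polyFun]

@[simp] lemma polyFun_sum {ι : Type*} (s : Finset ι) (p : ι → MvPolynomial (Fin d) ℂ)
    (x : EuclideanSpace ℝ (Fin d)) : polyFun (∑ i ∈ s, p i) x = ∑ i ∈ s, polyFun (p i) x := by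
  simp [polyFun]

/-- A complex polynomial is determined by its values at real points. -/
lemma polyFun_injective : Function.Injective (polyFun (d := d)) := by
  intro p q h
  refine MvPolynomial.funext_set (s := fun _ => Set.range ((↑) : ℝ → ℂ))
    (fun _ => Set.infinite_range_of_injective Complex.ofReal_injective) fun z hz => ?_
  choose y hy using fun i => hz i (Set.mem_univ i)
  have := congrFun h (WithLp.toLp 2 y)
  simpa [polyFun, hy] using this

lemma hasFDerivAt_polyFun (p : MvPolynomial (Fin d) ℂ) (x : EuclideanSpace ℝ (Fin d)) :
    HasFDerivAt (polyFun p) (∑ i, polyFun (pderiv i p) x •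
      (Complex.ofRealCLM.comp (EuclideanSpace.proj (𝕜 := ℝ) i))) x := by
  induction p using MvPolynomial.induction_on with
  | C a =>
    have : polyFun (d := d) (C a) = fun _ => a := by ext; simp
    rw [this]
    refine (hasFDerivAt_const a x).congr_fderiv ?_
    ext v
    simp
  | add p q hp hq =>
    have : polyFun (p + q) = polyFun p + polyFun q := by ext; simp
    rw [this]
    refine (hp.add hq).congr_fderiv ?_
    ext v
    simp [add_mul, Finset.sum_add_distrib]
  | mul_X p i hp =>
    have : polyFun (p * X i) = polyFun p *
      ⇑(Complex.ofRealCLM.comp (EuclideanSpace.proj (𝕜 := ℝ) i)) := by ext; simp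
    rw [this]
    refine (hp.mul
      (Complex.ofRealCLM.comp (EuclideanSpace.proj (𝕜 := ℝ) i)).hasFDerivAt).congr_fderiv ?_
    ext v
    simp only [Derivation.leibniz, pderiv_X, smul_eq_mul, polyFun_add, polyFun_mul, polyFun_X,
      add_mul, Finset.sum_add_distrib, add_apply, sum_apply, smul_apply,
      ContinuousLinearMap.comp_apply, Complex.ofRealCLM_apply, PiLp.proj_apply]
    congr 1
    · rw [Finset.sum_eq_single i]
      · simp
      · intro j _ hj; simp [Ne.symm hj]
      · simp
    · simp [Finset.mul_sum, mul_assoc]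

lemma differentiable_polyFun (p : MvPolynomial (Fin d) ℂ) : Differentiable ℝ (polyFun p) :=
  fun x => (hasFDerivAt_polyFun p x).differentiableAt

lemma continuous_polyFun (p : MvPolynomial (Fin d) ℂ) : Continuous (polyFun p) :=
  (differentiable_polyFun p).continuous

lemma fderiv_polyFun (p : MvPolynomial (Fin d) ℂ) (x v : EuclideanSpace ℝ (Fin d)) :
    fderiv ℝ (polyFun p) x v = ∑ i, ((v i : ℝ) : ℂ) * polyFun (pderiv i p) x := by
  rw [(hasFDerivAt_polyFun p x).fderiv]
  simp [mul_comm]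

lemma fderiv_polyFun_single (p : MvPolynomial (Fin d) ℂ) (x : EuclideanSpace ℝ (Fin d))
    (j : Fin d) :
    fderiv ℝ (polyFun p) x (EuclideanSpace.single j 1) = polyFun (pderiv j p) x := by
  rw [fderiv_polyFun, Finset.sum_eq_single j]
  · simp
  · intro i _ hi; simp [hi]
  · simp

/-- The linear form `⟨·, α⟩` as a polynomial. -/
def linForm (α : EuclideanSpace ℝ (Fin d)) : MvPolynomial (Fin d) ℂ :=
  ∑ i, C ((α i : ℝ) : ℂ) * X i

@[simp] lemma polyFun_linForm (α x : EuclideanSpace ℝ (Fin d)) :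
    polyFun (linForm α) x = ((inner ℝ x α : ℝ) : ℂ) := by
  simp [linForm, PiLp.inner_apply]

lemma isHomogeneous_linForm (α : EuclideanSpace ℝ (Fin d)) : (linForm α).IsHomogeneous 1 :=
  IsHomogeneous.sum _ _ _ fun i _ => isHomogeneous_C_mul_X _ i

/-- Composition of a polynomial with the reflection `σ_α`. -/
def reflPoly (α : EuclideanSpace ℝ (Fin d)) :
    MvPolynomial (Fin d) ℂ →ₐ[ℂ] MvPolynomial (Fin d) ℂ :=
  aeval fun i => X i - C ((α i : ℝ) : ℂ) * linForm α

@[simp] lemma reflPoly_X (α : EuclideanSpace ℝ (Fin d)) (i : Fin d) :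
    reflPoly α (X i) = X i - C ((α i : ℝ) : ℂ) * linForm α := by
  simp [reflPoly]

@[simp] lemma polyFun_reflPoly (α : EuclideanSpace ℝ (Fin d)) (p : MvPolynomial (Fin d) ℂ)
    (x : EuclideanSpace ℝ (Fin d)) : polyFun (reflPoly α p) x = polyFun p (rootReflection α x) := by
  induction p using MvPolynomial.induction_on with
  | C a => simp [reflPoly]
  | add p q hp hq => simp [hp, hq]
  | mul_X p i hp =>
    rw [map_mul, polyFun_mul, hp, polyFun_mul, reflPoly_X]
    simp [rootReflection, mul_comm]

lemma isHomogeneous_reflPoly (α : EuclideanSpace ℝ (Fin d)) {p : MvPolynomial (Fin d) ℂ} {n : ℕ}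
    (hp : p.IsHomogeneous n) : (reflPoly α p).IsHomogeneous n := by
  have := hp.aeval (n := 1) (fun i => X i - C ((α i : ℝ) : ℂ) * linForm α) fun i =>
    (isHomogeneous_X _ i).sub ((isHomogeneous_linForm α).C_mul _)
  simpa [reflPoly] using this

lemma rootReflection_of_inner_eq_zero {α x : EuclideanSpace ℝ (Fin d)} (h : inner ℝ x α = (0 : ℝ)) :
    rootReflection α x = x := by
  simp [rootReflection, h]

lemma diffQuot_X_mul (α : EuclideanSpace ℝ (Fin d)) (i : Fin d) (p : MvPolynomial (Fin d) ℂ)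
    (x : EuclideanSpace ℝ (Fin d)) :
    diffQuot α (polyFun (X i * p)) x = ((x i : ℝ) : ℂ) * diffQuot α (polyFun p) x
      + ((α i : ℝ) : ℂ) * polyFun p (rootReflection α x) := by
  unfold diffQuot
  split_ifs with h
  · simp only [fderiv_polyFun, rootReflection_of_inner_eq_zero h, Derivation.leibniz, pderiv_X,
      smul_eq_mul, polyFun_add, polyFun_mul, polyFun_X, mul_add, Finset.sum_add_distrib]
    congr 1
    · rw [Finset.mul_sum]
      exact Finset.sum_congr rfl fun k _ => by ring
    · rw [Finset.sum_eq_single i]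
      · simp
      · intro j _ hj; simp [Ne.symm hj]
      · simp
  · have h' : ((inner ℝ x α : ℝ) : ℂ) ≠ 0 := by exact_mod_cast h
    rw [polyFun_mul, polyFun_mul, polyFun_X, polyFun_X]
    have : ((rootReflection α x i : ℝ) : ℂ) = (x i : ℂ) - (inner ℝ x α : ℝ) * (α i : ℂ) := by
      simp [rootReflection]
    rw [this]
    field_simp
    ring

lemma diffQuot_add (α : EuclideanSpace ℝ (Fin d)) (p q : MvPolynomial (Fin d) ℂ)
    (x : EuclideanSpace ℝ (Fin d)) :
    diffQuot α (polyFun (p + q)) x = diffQuot α (polyFun p) x + diffQuot α (polyFun q) x := by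
  unfold diffQuot
  split_ifs with h
  · simp [fderiv_polyFun, mul_add, Finset.sum_add_distrib]
  · simp only [polyFun_add]; ring

lemma diffQuot_smul (α : EuclideanSpace ℝ (Fin d)) (c : ℂ) (p : MvPolynomial (Fin d) ℂ)
    (x : EuclideanSpace ℝ (Fin d)) :
    diffQuot α (polyFun (c • p)) x = c * diffQuot α (polyFun p) x := by
  unfold diffQuot
  split_ifs with h
  · simp [fderiv_polyFun, Finset.mul_sum, mul_left_comm]
  · simp only [polyFun_smul]; ring

/-- `p - p ∘ σ_α` is divisible by the linear form `⟨·, α⟩`: difference quotients of polynomials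
are polynomials. -/
lemma exists_polyFun_eq_diffQuot (α : EuclideanSpace ℝ (Fin d)) (p : MvPolynomial (Fin d) ℂ) :
    ∃ q, polyFun q = diffQuot α (polyFun p) := by
  induction p using MvPolynomial.induction_on with
  | C a => exact ⟨0, by ext x; simp [diffQuot, fderiv_polyFun]⟩
  | add p q hp hq =>
    obtain ⟨a, ha⟩ := hp
    obtain ⟨b, hb⟩ := hq
    exact ⟨a + b, by ext x; rw [diffQuot_add, polyFun_add, ha, hb]⟩
  | mul_X p i hp =>
    obtain ⟨a, ha⟩ := hp
    refine ⟨X i * a + C ((α i : ℝ) : ℂ) * reflPoly α p, ?_⟩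
    ext x
    rw [mul_comm p, diffQuot_X_mul]
    simp [ha]

/-- The difference quotient `(p - p ∘ σ_α) / ⟨·, α⟩` on polynomials. -/
def divDiff (α : EuclideanSpace ℝ (Fin d)) :
    MvPolynomial (Fin d) ℂ →ₗ[ℂ] MvPolynomial (Fin d) ℂ where
  toFun p := (exists_polyFun_eq_diffQuot α p).choose
  map_add' p q := polyFun_injective <| by
    ext x
    simp only [polyFun_add, (exists_polyFun_eq_diffQuot α _).choose_spec, diffQuot_add]
  map_smul' c p := polyFun_injective <| by
    ext x
    simp only [polyFun_smul, (exists_polyFun_eq_diffQuot α _).choose_spec, diffQuot_smul,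
      RingHom.id_apply]

lemma polyFun_divDiff (α : EuclideanSpace ℝ (Fin d)) (p : MvPolynomial (Fin d) ℂ)
    (x : EuclideanSpace ℝ (Fin d)) : polyFun (divDiff α p) x = diffQuot α (polyFun p) x :=
  congrFun (exists_polyFun_eq_diffQuot α p).choose_spec x

lemma linForm_mul_divDiff (α : EuclideanSpace ℝ (Fin d)) (p : MvPolynomial (Fin d) ℂ) :
    linForm α * divDiff α p = p - reflPoly α p := by
  refine polyFun_injective (funext fun x => ?_)
  rw [polyFun_mul, polyFun_linForm, polyFun_divDiff, polyFun_sub, polyFun_reflPoly, diffQuot]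
  split_ifs with h
  · simp [h, rootReflection_of_inner_eq_zero h]
  · have h' : ((inner ℝ x α : ℝ) : ℂ) ≠ 0 := by exact_mod_cast h
    field_simp

lemma divDiff_X_mul (α : EuclideanSpace ℝ (Fin d)) (i : Fin d) (p : MvPolynomial (Fin d) ℂ) :
    divDiff α (X i * p) = X i * divDiff α p + C ((α i : ℝ) : ℂ) * reflPoly α p := by
  refine polyFun_injective (funext fun x => ?_)
  rw [polyFun_divDiff, diffQuot_X_mul]
  simp [polyFun_divDiff]

lemma divDiff_C (α : EuclideanSpace ℝ (Fin d)) (c : ℂ) : divDiff α (C c) = 0 := by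
  refine polyFun_injective (funext fun x => ?_)
  rw [polyFun_divDiff]
  simp [diffQuot, fderiv_polyFun]

/-! ### Dunkl operators on polynomials -/

section DunklPoly

variable (Rp : Finset (EuclideanSpace ℝ (Fin d))) (κ : EuclideanSpace ℝ (Fin d) → ℝ)

/-- The Dunkl operator `T_j^κ` on polynomials. -/
def dunklPoly (j : Fin d) : MvPolynomial (Fin d) ℂ →ₗ[ℂ] MvPolynomial (Fin d) ℂ :=
  (pderiv j).toLinearMap + ∑ α ∈ Rp, ((κ α * α j : ℝ) : ℂ) • divDiff α

lemma dunklPoly_apply (j : Fin d) (p : MvPolynomial (Fin d) ℂ) :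
    dunklPoly Rp κ j p = pderiv j p + ∑ α ∈ Rp, ((κ α * α j : ℝ) : ℂ) • divDiff α p := by
  simp [dunklPoly, LinearMap.sum_apply]

lemma polyFun_dunklPoly (j : Fin d) (p : MvPolynomial (Fin d) ℂ) :
    polyFun (dunklPoly Rp κ j p) = dunklT Rp κ j (polyFun p) := by
  ext x
  rw [dunklPoly_apply, dunklT, fderiv_polyFun_single]
  simp [polyFun_divDiff]

lemma dunklPoly_C (j : Fin d) (c : ℂ) : dunklPoly Rp κ j (C c) = 0 := by
  simp [dunklPoly_apply, divDiff_C]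

/-- The commutation relation `[T_i, x_j] = δ_ij + ∑_α κ(α) α_i α_j σ_α`. -/
lemma dunklPoly_X_mul (i j : Fin d) (p : MvPolynomial (Fin d) ℂ) :
    dunklPoly Rp κ i (X j * p) = X j * dunklPoly Rp κ i p + (if i = j then p else 0)
      + ∑ α ∈ Rp, ((κ α * α i * α j : ℝ) : ℂ) • reflPoly α p := by
  simp only [dunklPoly_apply, divDiff_X_mul, Derivation.leibniz, pderiv_X, smul_eq_mul, smul_add,
    Finset.sum_add_distrib, mul_add, Finset.mul_sum, mul_smul_comm, C_mul', smul_smul,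
    Pi.single_apply]
  have : (p * if j = i then 1 else 0) = if i = j then p else 0 := by
    by_cases h : i = j <;> simp [h, eq_comm]
  rw [this]
  simp only [Complex.ofReal_mul]
  ring

lemma isHomogeneous_dunklPoly_X_mul (i j : Fin d) {p : MvPolynomial (Fin d) ℂ} {n : ℕ}
    (hp : p.IsHomogeneous n) (h : (dunklPoly Rp κ i p).IsHomogeneous (n - 1))
    (h0 : n = 0 → dunklPoly Rp κ i p = 0) : (dunklPoly Rp κ i (X j * p)).IsHomogeneous n := by
  rw [dunklPoly_X_mul]
  refine (IsHomogeneous.add ?_ ?_).add (IsHomogeneous.sum _ _ _ fun α _ => ?_)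
  · rcases Nat.eq_zero_or_pos n with hn | hn
    · simp [h0 hn, isHomogeneous_zero]
    · have := (isHomogeneous_X ℂ j).mul h
      rwa [Nat.add_sub_cancel' hn] at this
  · split_ifs
    exacts [hp, isHomogeneous_zero _ _ _]
  · rw [smul_eq_C_mul]
    exact (isHomogeneous_reflPoly α hp).C_mul _

lemma exists_isHomogeneous_dunklPoly_monomial (i : Fin d) (m : Fin d →₀ ℕ) (c : ℂ) :
    ∃ n, (monomial m c).IsHomogeneous n ∧
      (dunklPoly Rp κ i (monomial m c)).IsHomogeneous (n - 1) ∧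
      (n = 0 → dunklPoly Rp κ i (monomial m c) = 0) := by
  refine MvPolynomial.induction_on_monomial (motive := fun p => ∃ n, p.IsHomogeneous n ∧
    (dunklPoly Rp κ i p).IsHomogeneous (n - 1) ∧ (n = 0 → dunklPoly Rp κ i p = 0)) ?_ ?_ m c
  · exact fun a => ⟨0, isHomogeneous_C _ _, by simp [dunklPoly_C, isHomogeneous_zero]⟩
  · rintro p j ⟨n, hp, h, h0⟩
    refine ⟨n + 1, hp.mul (isHomogeneous_X _ j), ?_, by simp⟩
    rw [mul_comm]
    exact isHomogeneous_dunklPoly_X_mul Rp κ i j hp h h0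

/-- Dunkl operators lower the degree of homogeneous polynomials by one. -/
lemma isHomogeneous_dunklPoly (i : Fin d) {p : MvPolynomial (Fin d) ℂ} {n : ℕ}
    (hp : p.IsHomogeneous n) : (dunklPoly Rp κ i p).IsHomogeneous (n - 1) := by
  rw [p.as_sum, map_sum]
  refine IsHomogeneous.sum _ _ _ fun m hm => ?_
  obtain ⟨k, hk, h, -⟩ := exists_isHomogeneous_dunklPoly_monomial Rp κ i m (coeff m p)
  have hc : coeff m p ≠ 0 := mem_support_iff.1 hm
  have hkn : k = n := hk.inj_right
    (isHomogeneous_monomial _ ((hp.degree_eq_sum_deg_support hm).symm)) (by simpa using hc)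
  rwa [← hkn]

lemma dunklPoly_eq_zero (i : Fin d) {p : MvPolynomial (Fin d) ℂ} (hp : p.IsHomogeneous 0) :
    dunklPoly Rp κ i p = 0 := by
  obtain ⟨c, rfl⟩ : ∃ c, p = C c := ⟨_, totalDegree_eq_zero_iff_eq_C.1
    ((totalDegree_zero_iff_isHomogeneous _).2 hp)⟩
  exact dunklPoly_C Rp κ i c

end DunklPoly

/-! ### Reflections and root systems -/

/-- The reflection `σ_α` as a continuous linear map. -/
def reflCLM (α : EuclideanSpace ℝ (Fin d)) :
    EuclideanSpace ℝ (Fin d) →L[ℝ] EuclideanSpace ℝ (Fin d) :=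
  ContinuousLinearMap.id ℝ _ - (innerSL ℝ α).smulRight α

@[simp] lemma reflCLM_apply (α x : EuclideanSpace ℝ (Fin d)) :
    reflCLM α x = rootReflection α x := by
  simp [reflCLM, rootReflection, real_inner_comm]

lemma rootReflection_neg_left (α x : EuclideanSpace ℝ (Fin d)) :
    rootReflection (-α) x = rootReflection α x := by
  simp [rootReflection]

lemma rootReflection_neg (α x : EuclideanSpace ℝ (Fin d)) :
    rootReflection α (-x) = -rootReflection α x := by
  simp only [← reflCLM_apply, map_neg]

lemma rootReflection_self {α : EuclideanSpace ℝ (Fin d)} (h : inner ℝ α α = (2 : ℝ)) :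
    rootReflection α α = -α := by
  rw [rootReflection, h, two_smul]; abel

lemma inner_rootReflection {α : EuclideanSpace ℝ (Fin d)} (h : inner ℝ α α = (2 : ℝ))
    (x y : EuclideanSpace ℝ (Fin d)) :
    inner ℝ (rootReflection α x) (rootReflection α y) = (inner ℝ x y : ℝ) := by
  simp only [rootReflection, inner_sub_left, inner_sub_right, inner_smul_left, inner_smul_right,
    h, real_inner_comm α y, RCLike.conj_to_real]
  ring

lemma rootReflection_rootReflection {α : EuclideanSpace ℝ (Fin d)} (h : inner ℝ α α = (2 : ℝ))
    (x : EuclideanSpace ℝ (Fin d)) : rootReflection α (rootReflection α x) = x := by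
  rw [rootReflection, rootReflection, inner_sub_left, inner_smul_left, h, sub_sub, ← add_smul]
  simp only [RCLike.conj_to_real]
  rw [show (inner ℝ x α : ℝ) + (inner ℝ x α - inner ℝ x α * 2) = 0 by ring, zero_smul, sub_zero]

lemma norm_rootReflection {α : EuclideanSpace ℝ (Fin d)} (h : inner ℝ α α = (2 : ℝ))
    (x : EuclideanSpace ℝ (Fin d)) : ‖rootReflection α x‖ = ‖x‖ := by
  have := inner_rootReflection h x x
  rwa [real_inner_self_eq_norm_sq, real_inner_self_eq_norm_sq,
    pow_left_inj₀ (norm_nonneg _) (norm_nonneg _) two_ne_zero] at this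

/-- Conjugation of reflections: `σ_{σ_β α} σ_β = σ_β σ_α`. -/
lemma rootReflection_conj {β : EuclideanSpace ℝ (Fin d)} (h : inner ℝ β β = (2 : ℝ))
    (α x : EuclideanSpace ℝ (Fin d)) :
    rootReflection (rootReflection β α) (rootReflection β x)
      = rootReflection β (rootReflection α x) := by
  conv_lhs => rw [rootReflection, inner_rootReflection h]
  conv_rhs => rw [rootReflection.eq_def α, ← reflCLM_apply β]
  simp [map_sub]

section RootSystem

variable {R Rp : Finset (EuclideanSpace ℝ (Fin d))} {κ : EuclideanSpace ℝ (Fin d) → ℝ}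

lemma IsRootSystem.neg_mem (hR : IsRootSystem R) {α : EuclideanSpace ℝ (Fin d)} (hα : α ∈ R) :
    -α ∈ R := by
  have := hR.refl_mem α hα α hα
  rwa [rootReflection_self (hR.inner_self α hα)] at this

lemma IsMultiplicity.map_neg (hR : IsRootSystem R) (hκ : IsMultiplicity R κ)
    {α : EuclideanSpace ℝ (Fin d)} (hα : α ∈ R) : κ (-α) = κ α := by
  have := hκ.invariant α hα α hα
  rwa [rootReflection_self (hR.inner_self α hα)] at this

lemma IsPositiveSubsystem.subset (hRp : IsPositiveSubsystem R Rp) : Rp ⊆ R := by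
  obtain ⟨β, -, h⟩ := hRp
  exact fun α hα => ((h α).1 hα).1

/-- A reflection permutes the positive roots up to signs, so it does not change the product over
the positive roots of an even function. -/
@[to_additive]
lemma prod_positive_rootReflection {M : Type*} [CommMonoid M] (hR : IsRootSystem R)
    (hRp : IsPositiveSubsystem R Rp) {β : EuclideanSpace ℝ (Fin d)} (hβ : β ∈ R)
    (F : EuclideanSpace ℝ (Fin d) → M) (hF : ∀ α ∈ R, F (-α) = F α) :
    ∏ α ∈ Rp, F (rootReflection β α) = ∏ α ∈ Rp, F α := by
  classical
  obtain ⟨η, hη, h⟩ := hRp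
  have hββ := hR.inner_self β hβ
  -- the representative of `±σ_β α` that is positive
  let i : EuclideanSpace ℝ (Fin d) → EuclideanSpace ℝ (Fin d) := fun α =>
    if 0 < (inner ℝ (rootReflection β α) η : ℝ) then rootReflection β α else -rootReflection β α
  have hi : ∀ α ∈ Rp, i α ∈ Rp := by
    intro α hα
    have hm := hR.refl_mem β hβ α ((h α).1 hα).1
    simp only [i]
    split_ifs with h0
    · exact (h _).2 ⟨hm, h0⟩
    · refine (h _).2 ⟨hR.neg_mem hm, ?_⟩
      rw [inner_neg_left]
      have := lt_of_le_of_ne (not_lt.1 h0) (hη _ hm)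
      linarith
  have hii : ∀ α ∈ Rp, i (i α) = α := by
    intro α hα
    have hpos := ((h α).1 hα).2
    by_cases h0 : 0 < (inner ℝ (rootReflection β α) η : ℝ)
    · have : i α = rootReflection β α := if_pos h0
      rw [this]
      simp [i, rootReflection_rootReflection hββ, hpos]
    · have : i α = -rootReflection β α := if_neg h0
      rw [this]
      simp [i, rootReflection_neg, rootReflection_rootReflection hββ, hpos.le]
  refine Finset.prod_nbij' i i hi hi hii hii fun α hα => ?_
  have hm := hR.refl_mem β hβ α ((h α).1 hα).1
  simp only [i]
  split_ifs with h0
  · rfl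
  · exact (hF _ hm).symm

end RootSystem

/-! ### Commutation relations of the Dunkl operators -/

lemma reflPoly_reflPoly {β : EuclideanSpace ℝ (Fin d)} (h : inner ℝ β β = (2 : ℝ))
    (p : MvPolynomial (Fin d) ℂ) : reflPoly β (reflPoly β p) = p :=
  polyFun_injective <| funext fun x => by simp [rootReflection_rootReflection h]

lemma fderiv_polyFun_reflPoly (β : EuclideanSpace ℝ (Fin d)) (p : MvPolynomial (Fin d) ℂ)
    (x v : EuclideanSpace ℝ (Fin d)) : fderiv ℝ (polyFun (reflPoly β p)) x v
      = fderiv ℝ (polyFun p) (rootReflection β x) (rootReflection β v) := by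
  have h : polyFun (reflPoly β p) = polyFun p ∘ reflCLM β := by ext y; simp
  rw [h, fderiv_comp x (differentiable_polyFun p _) (reflCLM β).differentiableAt]
  simp

lemma pderiv_reflPoly (β : EuclideanSpace ℝ (Fin d)) (i : Fin d) (p : MvPolynomial (Fin d) ℂ) :
    pderiv i (reflPoly β p)
      = reflPoly β (pderiv i p - ((β i : ℝ) : ℂ) • ∑ k, ((β k : ℝ) : ℂ) • pderiv k p) := by
  refine polyFun_injective (funext fun x => ?_)
  rw [← fderiv_polyFun_single, fderiv_polyFun_reflPoly, rootReflection.eq_def β (EuclideanSpace.single i 1),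
    ContinuousLinearMap.map_sub, ContinuousLinearMap.map_smul, fderiv_polyFun_single,
    polyFun_reflPoly, fderiv_polyFun, polyFun_sub, polyFun_smul, polyFun_sum]
  simp only [polyFun_smul, EuclideanSpace.inner_single_left, map_one, one_mul, Complex.real_smul]

lemma divDiff_neg (α : EuclideanSpace ℝ (Fin d)) (p : MvPolynomial (Fin d) ℂ) :
    divDiff (-α) p = -divDiff α p := by
  refine polyFun_injective (funext fun x => ?_)
  have : polyFun (-divDiff α p) x = -polyFun (divDiff α p) x := by simp [polyFun]
  rw [this, polyFun_divDiff, polyFun_divDiff]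
  simp only [diffQuot, rootReflection_neg_left, inner_neg_right, neg_eq_zero]
  split_ifs
  · simp
  · simp [div_neg]

lemma divDiff_reflPoly {β : EuclideanSpace ℝ (Fin d)} (h : inner ℝ β β = (2 : ℝ))
    (α : EuclideanSpace ℝ (Fin d)) (p : MvPolynomial (Fin d) ℂ) :
    divDiff α (reflPoly β p) = reflPoly β (divDiff (rootReflection β α) p) := by
  refine polyFun_injective (funext fun x => ?_)
  rw [polyFun_divDiff, polyFun_reflPoly, polyFun_divDiff]
  simp only [diffQuot, fderiv_polyFun_reflPoly, inner_rootReflection h, polyFun_reflPoly,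
    rootReflection_conj h]

section Commutation

variable {R Rp : Finset (EuclideanSpace ℝ (Fin d))} {κ : EuclideanSpace ℝ (Fin d) → ℝ}

variable (Rp κ) in
/-- The Dunkl operator `T_β = ∑_k β_k T_k` in the direction `β`, on polynomials. -/
def dunklDir (β : EuclideanSpace ℝ (Fin d)) : MvPolynomial (Fin d) ℂ →ₗ[ℂ] MvPolynomial (Fin d) ℂ :=
  ∑ k, ((β k : ℝ) : ℂ) • dunklPoly Rp κ k

lemma dunklDir_apply (β : EuclideanSpace ℝ (Fin d)) (p : MvPolynomial (Fin d) ℂ) :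
    dunklDir Rp κ β p = ∑ k, ((β k : ℝ) : ℂ) • dunklPoly Rp κ k p := by
  simp [dunklDir, LinearMap.sum_apply]

lemma dunklDir_eq (β : EuclideanSpace ℝ (Fin d)) (p : MvPolynomial (Fin d) ℂ) :
    dunklDir Rp κ β p = ∑ k, ((β k : ℝ) : ℂ) • pderiv k p
      + ∑ α ∈ Rp, ((κ α * inner ℝ α β : ℝ) : ℂ) • divDiff α p := by
  simp only [dunklDir_apply, dunklPoly_apply, smul_add, Finset.sum_add_distrib, Finset.smul_sum,
    smul_smul]
  rw [Finset.sum_comm]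
  congr 1
  refine Finset.sum_congr rfl fun α _ => ?_
  rw [← Finset.sum_smul]
  congr 1
  simp only [PiLp.inner_apply, RCLike.inner_apply, conj_trivial]
  push_cast
  rw [Finset.mul_sum]
  exact Finset.sum_congr rfl fun k _ => by ring

/-- Equivariance of the Dunkl operators: `T_i σ_β = σ_β (T_i - β_i T_β)`. -/
lemma dunklPoly_reflPoly (hR : IsRootSystem R) (hRp : IsPositiveSubsystem R Rp)
    (hκ : IsMultiplicity R κ) {β : EuclideanSpace ℝ (Fin d)} (hβ : β ∈ R) (i : Fin d)
    (p : MvPolynomial (Fin d) ℂ) :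
    dunklPoly Rp κ i (reflPoly β p)
      = reflPoly β (dunklPoly Rp κ i p - ((β i : ℝ) : ℂ) • dunklDir Rp κ β p) := by
  have hββ := hR.inner_self β hβ
  have key : ∑ α ∈ Rp, ((κ α * α i : ℝ) : ℂ) • divDiff (rootReflection β α) p
      = ∑ α ∈ Rp, ((κ α * rootReflection β α i : ℝ) : ℂ) • divDiff α p := by
    rw [← sum_positive_rootReflection hR hRp hβ
      (fun α => ((κ α * rootReflection β α i : ℝ) : ℂ) • divDiff α p)]
    · refine Finset.sum_congr rfl fun α hα => ?_
      rw [hκ.invariant β hβ α (hRp.subset hα), rootReflection_rootReflection hββ]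
    · intro α hα
      simp [hκ.map_neg hR hα, divDiff_neg, rootReflection_neg]
  rw [dunklPoly_apply, pderiv_reflPoly]
  simp only [divDiff_reflPoly hββ, ← map_smul (reflPoly β), ← map_sum (reflPoly β),
    ← map_add (reflPoly β)]
  rw [key, dunklDir_eq, dunklPoly_apply]
  congr 1
  simp only [rootReflection, PiLp.sub_apply, PiLp.smul_apply, smul_eq_mul, smul_add,
    Finset.smul_sum, smul_smul, mul_sub, Complex.ofReal_sub, sub_smul, Finset.sum_sub_distrib]
  have : ∀ α : EuclideanSpace ℝ (Fin d), ((κ α * (inner ℝ α β * β i) : ℝ) : ℂ)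
      = (β i : ℂ) * ((κ α * inner ℝ α β : ℝ) : ℂ) := fun α => by push_cast; ring
  simp only [this]
  abel

lemma dunklPoly_dunklPoly_X_mul (hR : IsRootSystem R) (hRp : IsPositiveSubsystem R Rp)
    (hκ : IsMultiplicity R κ) (i j k : Fin d) (p : MvPolynomial (Fin d) ℂ) :
    dunklPoly Rp κ i (dunklPoly Rp κ j (X k * p)) = X k * dunklPoly Rp κ i (dunklPoly Rp κ j p)
      + (if i = k then dunklPoly Rp κ j p else 0) + (if j = k then dunklPoly Rp κ i p else 0)
      + ∑ α ∈ Rp, ((κ α * α k : ℝ) : ℂ) • reflPoly α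
        (((α i : ℝ) : ℂ) • dunklPoly Rp κ j p + ((α j : ℝ) : ℂ) • dunklPoly Rp κ i p
          - ((α i * α j : ℝ) : ℂ) • dunklDir Rp κ α p) := by
  rw [dunklPoly_X_mul, map_add, map_add, dunklPoly_X_mul, map_sum]
  have h1 : dunklPoly Rp κ i (if j = k then p else 0) = if j = k then dunklPoly Rp κ i p else 0 := by
    split_ifs <;> simp
  have h2 : ∀ α ∈ Rp, dunklPoly Rp κ i (((κ α * α j * α k : ℝ) : ℂ) • reflPoly α p)
      = ((κ α * α j * α k : ℝ) : ℂ) • reflPoly α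
        (dunklPoly Rp κ i p - ((α i : ℝ) : ℂ) • dunklDir Rp κ α p) := fun α hα => by
    rw [map_smul, dunklPoly_reflPoly hR hRp hκ (hRp.subset hα)]
  rw [h1, Finset.sum_congr rfl h2]
  have h3 : ∀ a b c e : MvPolynomial (Fin d) ℂ, ∀ f g : MvPolynomial (Fin d) ℂ,
      f + g = e → a + b + f + c + g = a + b + c + e := by
    rintro a b c _ f g rfl; abel
  refine h3 _ _ _ _ _ _ ?_
  rw [← Finset.sum_add_distrib]
  refine Finset.sum_congr rfl fun α _ => ?_
  simp only [map_add, map_sub, map_smul, smul_add, smul_sub, smul_smul]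
  push_cast
  module

/-- The Dunkl operators commute: their commutator commutes with multiplication by the coordinates,
because `T_i T_j x_k - x_k T_i T_j` is symmetric in `i` and `j`, and it kills the constants. -/
lemma dunklPoly_comm (hR : IsRootSystem R) (hRp : IsPositiveSubsystem R Rp)
    (hκ : IsMultiplicity R κ) (i j : Fin d) (p : MvPolynomial (Fin d) ℂ) :
    dunklPoly Rp κ i (dunklPoly Rp κ j p) = dunklPoly Rp κ j (dunklPoly Rp κ i p) := by
  induction p using MvPolynomial.induction_on with
  | C a => simp [dunklPoly_C]
  | add p q hp hq => simp [hp, hq]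
  | mul_X p k hp =>
    rw [mul_comm, dunklPoly_dunklPoly_X_mul hR hRp hκ, dunklPoly_dunklPoly_X_mul hR hRp hκ, hp]
    have : ∀ α ∈ Rp, ((κ α * α k : ℝ) : ℂ) • reflPoly α
        (((α i : ℝ) : ℂ) • dunklPoly Rp κ j p + ((α j : ℝ) : ℂ) • dunklPoly Rp κ i p
          - ((α i * α j : ℝ) : ℂ) • dunklDir Rp κ α p)
        = ((κ α * α k : ℝ) : ℂ) • reflPoly α
        (((α j : ℝ) : ℂ) • dunklPoly Rp κ i p + ((α i : ℝ) : ℂ) • dunklPoly Rp κ j p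
          - ((α j * α i : ℝ) : ℂ) • dunklDir Rp κ α p) := fun α _ => by
      rw [add_comm (((α i : ℝ) : ℂ) • _), mul_comm (α i)]
    rw [Finset.sum_congr rfl this]
    abel

variable (Rp κ) in
/-- The Dunkl Laplacian on polynomials. -/
def laplPoly : MvPolynomial (Fin d) ℂ →ₗ[ℂ] MvPolynomial (Fin d) ℂ :=
  ∑ j, dunklPoly Rp κ j ∘ₗ dunklPoly Rp κ j

lemma laplPoly_apply (p : MvPolynomial (Fin d) ℂ) :
    laplPoly Rp κ p = ∑ j, dunklPoly Rp κ j (dunklPoly Rp κ j p) := by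
  simp [laplPoly, LinearMap.sum_apply]

lemma polyFun_laplPoly (p : MvPolynomial (Fin d) ℂ) :
    polyFun (laplPoly Rp κ p) = dunklLaplacian Rp κ (polyFun p) := by
  ext x
  simp [laplPoly_apply, dunklLaplacian, polyFun_dunklPoly]

lemma laplPoly_dunklPoly (hR : IsRootSystem R) (hRp : IsPositiveSubsystem R Rp)
    (hκ : IsMultiplicity R κ) (i : Fin d) (p : MvPolynomial (Fin d) ℂ) :
    laplPoly Rp κ (dunklPoly Rp κ i p) = dunklPoly Rp κ i (laplPoly Rp κ p) := by
  simp only [laplPoly_apply, map_sum, dunklPoly_comm hR hRp hκ _ i]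

lemma sum_sq_eq_two (hR : IsRootSystem R)
    {α : EuclideanSpace ℝ (Fin d)} (hα : α ∈ R) : ∑ i, ((α i : ℝ) : ℂ) * ((α i : ℝ) : ℂ) = 2 := by
  have := hR.inner_self α hα
  simp only [PiLp.inner_apply, RCLike.inner_apply, conj_trivial] at this
  exact_mod_cast this

/-- The relation `[Δ, x_k] = 2 T_k`. -/
lemma laplPoly_X_mul (hR : IsRootSystem R) (hRp : IsPositiveSubsystem R Rp)
    (hκ : IsMultiplicity R κ) (k : Fin d) (p : MvPolynomial (Fin d) ℂ) :
    laplPoly Rp κ (X k * p) = X k * laplPoly Rp κ p + (2 : ℂ) • dunklPoly Rp κ k p := by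
  simp only [laplPoly_apply, dunklPoly_dunklPoly_X_mul hR hRp hκ, Finset.sum_add_distrib]
  rw [Finset.sum_comm, ← Finset.mul_sum]
  have : ∑ α ∈ Rp, ∑ i, ((κ α * α k : ℝ) : ℂ) • reflPoly α
        (((α i : ℝ) : ℂ) • dunklPoly Rp κ i p + ((α i : ℝ) : ℂ) • dunklPoly Rp κ i p
          - ((α i * α i : ℝ) : ℂ) • dunklDir Rp κ α p) = 0 := by
    refine Finset.sum_eq_zero fun α hα => ?_
    rw [← Finset.smul_sum, ← map_sum, Finset.sum_sub_distrib, Finset.sum_add_distrib,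
      ← dunklDir_apply, ← Finset.sum_smul]
    have : ∑ i, ((α i * α i : ℝ) : ℂ) = 2 := by
      simpa using sum_sq_eq_two hR (hRp.subset hα)
    rw [this, two_smul, sub_self, map_zero, smul_zero]
  rw [this]
  simp [two_smul, add_assoc]

/-- The Dunkl Laplacian commutes with the reflections. -/
lemma laplPoly_reflPoly (hR : IsRootSystem R) (hRp : IsPositiveSubsystem R Rp)
    (hκ : IsMultiplicity R κ) {β : EuclideanSpace ℝ (Fin d)} (hβ : β ∈ R)
    (p : MvPolynomial (Fin d) ℂ) :
    laplPoly Rp κ (reflPoly β p) = reflPoly β (laplPoly Rp κ p) := by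
  have hcomm : ∀ i, dunklDir Rp κ β (dunklPoly Rp κ i p) = dunklPoly Rp κ i (dunklDir Rp κ β p) :=
    fun i => by simp only [dunklDir_apply, map_sum, map_smul, dunklPoly_comm hR hRp hκ _ i]
  simp only [laplPoly_apply, dunklPoly_reflPoly hR hRp hκ hβ, ← map_sum (reflPoly β)]
  congr 1
  simp only [map_sub, map_smul, hcomm, smul_sub, Finset.sum_sub_distrib, smul_smul,
    ← Finset.sum_smul, sum_sq_eq_two hR hβ, ← dunklDir_apply]
  module

end Commutation

/-! ### The operator `e^{-Δ/4}` on polynomials -/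

section ExpLaplacian

variable {R Rp : Finset (EuclideanSpace ℝ (Fin d))} {κ : EuclideanSpace ℝ (Fin d) → ℝ}

lemma isHomogeneous_laplPoly {p : MvPolynomial (Fin d) ℂ} {n : ℕ} (hp : p.IsHomogeneous n) :
    (laplPoly Rp κ p).IsHomogeneous (n - 1 - 1) := by
  rw [laplPoly_apply]
  exact IsHomogeneous.sum _ _ _ fun i _ =>
    isHomogeneous_dunklPoly Rp κ i (isHomogeneous_dunklPoly Rp κ i hp)

lemma laplPoly_pow_eq_zero_of_isHomogeneous {p : MvPolynomial (Fin d) ℂ} {n k : ℕ}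
    (hp : p.IsHomogeneous n) (h : n < k) : (laplPoly Rp κ ^ k) p = 0 := by
  induction k generalizing n p with
  | zero => omega
  | succ k ih =>
    rw [pow_succ, Module.End.mul_apply]
    rcases Nat.eq_zero_or_pos n with rfl | hn
    · simp [laplPoly_apply, dunklPoly_eq_zero Rp κ _ hp]
    · exact ih (isHomogeneous_laplPoly hp) (by omega)

lemma laplPoly_pow_eq_zero {p : MvPolynomial (Fin d) ℂ} {k : ℕ} (h : p.totalDegree < k) :
    (laplPoly Rp κ ^ k) p = 0 := by
  rw [← sum_homogeneousComponent p, map_sum]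
  exact Finset.sum_eq_zero fun i hi => laplPoly_pow_eq_zero_of_isHomogeneous
    (homogeneousComponent_isHomogeneous i p) (by have := Finset.mem_range.1 hi; omega)

variable (Rp κ) in
/-- The partial sums of the series for `e^{-Δ/4}`. -/
def expSum (N : ℕ) : MvPolynomial (Fin d) ℂ →ₗ[ℂ] MvPolynomial (Fin d) ℂ :=
  ∑ k ∈ Finset.range N, ((-1 / 4 : ℂ) ^ k / (k.factorial : ℂ)) • laplPoly Rp κ ^ k

lemma expSum_apply (N : ℕ) (p : MvPolynomial (Fin d) ℂ) : expSum Rp κ N p =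
    ∑ k ∈ Finset.range N, ((-1 / 4 : ℂ) ^ k / (k.factorial : ℂ)) • (laplPoly Rp κ ^ k) p := by
  simp [expSum, LinearMap.sum_apply]

lemma expSum_eq_of_lt {p : MvPolynomial (Fin d) ℂ} {N : ℕ} (h : p.totalDegree < N) :
    expSum Rp κ N p = expSum Rp κ (p.totalDegree + 1) p := by
  rw [expSum_apply, expSum_apply]
  refine (Finset.sum_subset (Finset.range_subset_range.2 h) fun k _ hk => ?_).symm
  rw [laplPoly_pow_eq_zero (by rw [Finset.mem_range] at hk; omega), smul_zero]

variable (Rp κ) in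
/-- The operator `e^{-Δ/4}` on polynomials; the exponential series terminates on each of them. -/
def expPoly : MvPolynomial (Fin d) ℂ →ₗ[ℂ] MvPolynomial (Fin d) ℂ where
  toFun p := expSum Rp κ (p.totalDegree + 1) p
  map_add' p q := by
    have h := totalDegree_add p q
    rw [← expSum_eq_of_lt (p := p) (N := max p.totalDegree q.totalDegree + 1) (by grind),
      ← expSum_eq_of_lt (p := q) (N := max p.totalDegree q.totalDegree + 1) (by grind),
      ← expSum_eq_of_lt (p := p + q) (N := max p.totalDegree q.totalDegree + 1) (by omega), map_add]
  map_smul' c p := by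
    have h := totalDegree_smul_le c p
    rw [← expSum_eq_of_lt (p := c • p) (N := p.totalDegree + 1) (by omega), map_smul,
      RingHom.id_apply]

lemma expPoly_eq {p : MvPolynomial (Fin d) ℂ} {N : ℕ} (h : p.totalDegree < N) :
    expPoly Rp κ p = expSum Rp κ N p :=
  (expSum_eq_of_lt h).symm

/-- An operator commuting with the Dunkl Laplacian commutes with `e^{-Δ/4}`. -/
lemma expPoly_comm {A : MvPolynomial (Fin d) ℂ →ₗ[ℂ] MvPolynomial (Fin d) ℂ}
    (hA : ∀ p, laplPoly Rp κ (A p) = A (laplPoly Rp κ p)) (p : MvPolynomial (Fin d) ℂ) :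
    expPoly Rp κ (A p) = A (expPoly Rp κ p) := by
  have hpow : ∀ k q, (laplPoly Rp κ ^ k) (A q) = A ((laplPoly Rp κ ^ k) q) := by
    intro k
    induction k with
    | zero => simp
    | succ k ih => intro q; rw [pow_succ, Module.End.mul_apply, hA, ih, Module.End.mul_apply]
  rw [expPoly_eq (N := max p.totalDegree (A p).totalDegree + 1) (by grind),
    expPoly_eq (N := max p.totalDegree (A p).totalDegree + 1) (by grind), expSum_apply,
    expSum_apply, map_sum]
  exact Finset.sum_congr rfl fun k _ => by rw [hpow, map_smul]

lemma expPoly_dunklPoly (hR : IsRootSystem R) (hRp : IsPositiveSubsystem R Rp)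
    (hκ : IsMultiplicity R κ) (i : Fin d) (p : MvPolynomial (Fin d) ℂ) :
    expPoly Rp κ (dunklPoly Rp κ i p) = dunklPoly Rp κ i (expPoly Rp κ p) :=
  expPoly_comm (laplPoly_dunklPoly hR hRp hκ i) p

lemma expPoly_reflPoly (hR : IsRootSystem R) (hRp : IsPositiveSubsystem R Rp)
    (hκ : IsMultiplicity R κ) {β : EuclideanSpace ℝ (Fin d)} (hβ : β ∈ R)
    (p : MvPolynomial (Fin d) ℂ) :
    expPoly Rp κ (reflPoly β p) = reflPoly β (expPoly Rp κ p) :=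
  expPoly_comm (A := (reflPoly β).toLinearMap) (laplPoly_reflPoly hR hRp hκ hβ) p

lemma laplPoly_pow_succ_X_mul (hR : IsRootSystem R) (hRp : IsPositiveSubsystem R Rp)
    (hκ : IsMultiplicity R κ) (j : Fin d) (k : ℕ) (p : MvPolynomial (Fin d) ℂ) :
    (laplPoly Rp κ ^ (k + 1)) (X j * p) = X j * (laplPoly Rp κ ^ (k + 1)) p
      + (2 * (k + 1) : ℂ) • dunklPoly Rp κ j ((laplPoly Rp κ ^ k) p) := by
  induction k with
  | zero => simp [laplPoly_X_mul hR hRp hκ]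
  | succ k ih =>
    rw [pow_succ', Module.End.mul_apply, ih, map_add, laplPoly_X_mul hR hRp hκ, map_smul,
      laplPoly_dunklPoly hR hRp hκ, ← Module.End.mul_apply (laplPoly Rp κ), ← pow_succ',
      ← Module.End.mul_apply (laplPoly Rp κ), ← pow_succ']
    push_cast
    module

/-- Conjugation of a coordinate by `e^{-Δ/4}`: `e^{-Δ/4} x_j = (x_j - T_j / 2) e^{-Δ/4}`. -/
lemma expPoly_X_mul (hR : IsRootSystem R) (hRp : IsPositiveSubsystem R Rp)
    (hκ : IsMultiplicity R κ) (j : Fin d) (p : MvPolynomial (Fin d) ℂ) :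
    expPoly Rp κ (X j * p) = X j * expPoly Rp κ p
      - (1 / 2 : ℂ) • dunklPoly Rp κ j (expPoly Rp κ p) := by
  set N := max p.totalDegree (X j * p).totalDegree + 1 with hN
  have h1 : expPoly Rp κ (X j * p) = expSum Rp κ (N + 1) (X j * p) := expPoly_eq (by grind)
  have h2 : X j * expPoly Rp κ p = X j * expSum Rp κ (N + 1) p := by
    rw [expPoly_eq (N := N + 1) (by grind)]
  have h3 : dunklPoly Rp κ j (expPoly Rp κ p) = dunklPoly Rp κ j (expSum Rp κ N p) := by
    rw [expPoly_eq (N := N) (by grind)]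
  rw [h1, h2, h3, expSum_apply, expSum_apply, expSum_apply, Finset.sum_range_succ',
    Finset.sum_range_succ' _ N, mul_add, Finset.mul_sum, map_sum, Finset.smul_sum]
  have : ∀ k ∈ Finset.range N,
      ((-1 / 4 : ℂ) ^ (k + 1) / ((k + 1).factorial : ℂ)) • (laplPoly Rp κ ^ (k + 1)) (X j * p)
      = X j * (((-1 / 4 : ℂ) ^ (k + 1) / ((k + 1).factorial : ℂ)) • (laplPoly Rp κ ^ (k + 1)) p)
        - (1 / 2 : ℂ) • dunklPoly Rp κ j
          (((-1 / 4 : ℂ) ^ k / (k.factorial : ℂ)) • (laplPoly Rp κ ^ k) p) := fun k _ => by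
    rw [laplPoly_pow_succ_X_mul hR hRp hκ, smul_add, smul_smul, mul_smul_comm, map_smul, smul_smul,
      sub_eq_add_neg, ← neg_smul]
    congr 2
    have h1 : ((k : ℂ) + 1) ≠ 0 := by exact_mod_cast k.succ_ne_zero
    have h2 : (k.factorial : ℂ) ≠ 0 := by exact_mod_cast k.factorial_ne_zero
    rw [Nat.factorial_succ]
    push_cast
    field_simp
    ring
  rw [Finset.sum_congr rfl this, Finset.sum_sub_distrib]
  simp
  abel

lemma expPoly_C (c : ℂ) : expPoly Rp κ (C c) = C c := by
  rw [expPoly_eq (N := 1) (by simp), expSum_apply]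
  simp

/-- `e^{-Δ/4}` is surjective, since `e^{-Δ/4} - 1` is locally nilpotent. -/
lemma expPoly_surjective : Function.Surjective (expPoly Rp κ) := by
  suffices h : ∀ N p, (laplPoly Rp κ ^ N) p = 0 → ∃ q, expPoly Rp κ q = p from
    fun p => h _ p (laplPoly_pow_eq_zero (Nat.lt_succ_self _))
  intro N
  induction N with
  | zero => exact fun p hp => ⟨0, by simpa using hp.symm⟩
  | succ N ih =>
    intro p hp
    obtain ⟨q, hq⟩ := ih (expPoly Rp κ p - p) <| by
      rw [expPoly_eq (p := p) (Nat.lt_succ_self _), expSum_apply, Finset.sum_range_succ']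
      simp only [pow_zero, Nat.factorial_zero, Nat.cast_one, div_one, one_smul,
        Module.End.one_apply, add_sub_cancel_right, map_sum, map_smul]
      refine Finset.sum_eq_zero fun k _ => ?_
      rw [← Module.End.mul_apply, ← pow_add, show N + (k + 1) = k + (N + 1) by ring,
        pow_add (laplPoly Rp κ),
        Module.End.mul_apply, hp, map_zero, smul_zero]
    exact ⟨p - q, by rw [map_sub, hq]; abel⟩

lemma polyFun_laplPoly_pow (k : ℕ) (p : MvPolynomial (Fin d) ℂ) :
    polyFun ((laplPoly Rp κ ^ k) p) = (dunklLaplacian Rp κ)^[k] (polyFun p) := by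
  induction k generalizing p with
  | zero => simp
  | succ k ih =>
    rw [pow_succ, Module.End.mul_apply, ih, polyFun_laplPoly, Function.iterate_succ_apply]

lemma polyFun_expPoly (p : MvPolynomial (Fin d) ℂ) (x : EuclideanSpace ℝ (Fin d)) :
    polyFun (expPoly Rp κ p) x = expLaplacian Rp κ p x := by
  rw [expPoly_eq (Nat.lt_succ_self _), expSum_apply]
  simp [expLaplacian, polyFun_laplPoly_pow]

/-- The Euler operator of Dunkl theory: on homogeneous polynomials of degree `n`,
`∑_j x_j T_j = n + ∑_α κ(α) (1 - σ_α)`. -/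
lemma sum_X_mul_dunklPoly {p : MvPolynomial (Fin d) ℂ} {n : ℕ} (hp : p.IsHomogeneous n) :
    ∑ j, X j * dunklPoly Rp κ j p
      = (n : ℂ) • p + ∑ α ∈ Rp, ((κ α : ℝ) : ℂ) • (p - reflPoly α p) := by
  simp only [dunklPoly_apply, mul_add, Finset.sum_add_distrib, hp.sum_X_mul_pderiv]
  congr 1
  · simp [nsmul_eq_mul, smul_eq_C_mul]
  · simp only [Finset.mul_sum]
    rw [Finset.sum_comm]
    refine Finset.sum_congr rfl fun α _ => ?_
    rw [← linForm_mul_divDiff, linForm, Finset.sum_mul, Finset.smul_sum]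
    refine Finset.sum_congr rfl fun j _ => ?_
    simp only [smul_eq_C_mul, Complex.ofReal_mul, map_mul]
    ring

/-! ### Monomials in the Dunkl operators -/

variable (Rp κ) in
/-- The operator `∏_{j ∈ l} T_j^{m_j}` on polynomials, the factors being in the order of the list
`l`. -/
def listPoly (m : Fin d →₀ ℕ) (l : List (Fin d)) (p : MvPolynomial (Fin d) ℂ) :
    MvPolynomial (Fin d) ℂ :=
  l.foldr (fun j q => (dunklPoly Rp κ j)^[m j] q) p

lemma polyFun_listPoly (m : Fin d →₀ ℕ) (p : MvPolynomial (Fin d) ℂ) :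
    polyFun (listPoly Rp κ m (List.finRange d) p) = monomialT Rp κ m (polyFun p) := by
  have hit : ∀ (j : Fin d) (k : ℕ) (q : MvPolynomial (Fin d) ℂ),
      polyFun ((dunklPoly Rp κ j)^[k] q) = (dunklT Rp κ j)^[k] (polyFun q) := by
    intro j k
    induction k with
    | zero => simp
    | succ k ih => intro q; simp [ih, polyFun_dunklPoly]
  rw [listPoly, monomialT]
  induction List.finRange d with
  | nil => rfl
  | cons j l ih => rw [List.foldr_cons, List.foldr_cons, hit, ih]

lemma isHomogeneous_iterate_dunklPoly (j : Fin d) (k : ℕ) {p : MvPolynomial (Fin d) ℂ} {n : ℕ}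
    (hp : p.IsHomogeneous n) : ((dunklPoly Rp κ j)^[k] p).IsHomogeneous (n - k) ∧
      (n < k → (dunklPoly Rp κ j)^[k] p = 0) := by
  induction k generalizing n p with
  | zero => simpa using hp
  | succ k ih =>
    obtain ⟨h1, h2⟩ := ih (isHomogeneous_dunklPoly Rp κ j hp)
    rw [Function.iterate_succ_apply]
    refine ⟨by rwa [Nat.sub_sub, add_comm] at h1, fun h => ?_⟩
    rcases Nat.eq_zero_or_pos n with rfl | hn
    · rw [dunklPoly_eq_zero Rp κ j hp, iterate_map_zero]
    · exact h2 (by omega)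

lemma isHomogeneous_listPoly (m : Fin d →₀ ℕ) (l : List (Fin d)) {p : MvPolynomial (Fin d) ℂ}
    {n : ℕ} (hp : p.IsHomogeneous n) : (listPoly Rp κ m l p).IsHomogeneous (n - (l.map m).sum) ∧
      (n < (l.map m).sum → listPoly Rp κ m l p = 0) := by
  induction l with
  | nil => simpa [listPoly] using hp
  | cons j l ih =>
    obtain ⟨h1, h2⟩ := ih
    obtain ⟨h3, h4⟩ := isHomogeneous_iterate_dunklPoly (Rp := Rp) (κ := κ) j (m j) h1
    have heq : listPoly Rp κ m (j :: l) p = (dunklPoly Rp κ j)^[m j] (listPoly Rp κ m l p) := rfl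
    rw [heq, List.map_cons, List.sum_cons]
    refine ⟨by rwa [Nat.sub_sub, add_comm] at h3, fun h => ?_⟩
    by_cases hlt : n < (l.map m).sum
    · rw [h2 hlt, iterate_map_zero]
    · exact h4 (by omega)

/-! ### Consequences of the adjunction between `x_j` and `T_j / 2` -/

variable {H : Type*} [NormedAddCommGroup H] [InnerProductSpace ℂ H]

lemma inner_listProd (U : MvPolynomial (Fin d) ℂ →ₗ[ℂ] H)
    (hU : ∀ j p q, inner ℂ (U (X j * p)) (U q) = (1 / 2 : ℂ) * inner ℂ (U p) (U (dunklPoly Rp κ j q)))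
    (m : Fin d →₀ ℕ) (l : List (Fin d)) (p q : MvPolynomial (Fin d) ℂ) :
    inner ℂ (U ((l.map fun j => X j ^ m j).prod * p)) (U q)
      = (1 / 2 : ℂ) ^ (l.map m).sum * inner ℂ (U p) (U (listPoly Rp κ m l q)) := by
  have hit : ∀ (j : Fin d) (k : ℕ) (p q : MvPolynomial (Fin d) ℂ),
      inner ℂ (U (X j ^ k * p)) (U q)
        = (1 / 2 : ℂ) ^ k * inner ℂ (U p) (U ((dunklPoly Rp κ j)^[k] q)) := by
    intro j k
    induction k with
    | zero => simp
    | succ k ih =>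
      intro p q
      rw [pow_succ', mul_assoc, hU, ih, Function.iterate_succ_apply, pow_succ']
      ring
  induction l generalizing p with
  | nil => simp [listPoly]
  | cons j l ih =>
    have heq : listPoly Rp κ m (j :: l) q = (dunklPoly Rp κ j)^[m j] (listPoly Rp κ m l q) := rfl
    rw [heq, List.map_cons, List.prod_cons, List.map_cons, List.sum_cons,
      mul_comm (X j ^ m j), mul_assoc, ih, hit, pow_add]
    ring

/-- If multiplication by `x_j` is adjoint to `T_j / 2` for an inner product, then this inner product
is a multiple of the pairing `[p, q]_κ = (p(T) q)(0)` on homogeneous polynomials. -/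
lemma inner_eq_pairing (U : MvPolynomial (Fin d) ℂ →ₗ[ℂ] H)
    (hU : ∀ j p q, inner ℂ (U (X j * p)) (U q) = (1 / 2 : ℂ) * inner ℂ (U p) (U (dunklPoly Rp κ j q)))
    {p q : MvPolynomial (Fin d) ℂ} {n k : ℕ} (hp : p.IsHomogeneous n) (hq : q.IsHomogeneous k)
    (hkn : k ≤ n) (hreal : ∀ m, (coeff m p).im = 0) :
    inner ℂ (U p) (U q) = (1 / 2 : ℂ) ^ n * pairing Rp κ p q * inner ℂ (U 1) (U 1) := by
  have hterm : ∀ m ∈ p.support, inner ℂ (U (monomial m (coeff m p))) (U q)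
      = (1 / 2 : ℂ) ^ n * (coeff m p * monomialT Rp κ m (polyFun q) 0) * inner ℂ (U 1) (U 1) := by
    intro m hm
    have hdeg : ((List.finRange d).map m).sum = n := by
      rw [hp.degree_eq_sum_deg_support hm, ← Fin.sum_univ_def, ← Finsupp.degree_eq_sum]
      rfl
    have hmon : monomial m (coeff m p)
        = coeff m p • (((List.finRange d).map fun j => X j ^ m j).prod * 1) := by
      rw [← Fin.prod_univ_def, mul_one, monomial_eq, smul_eq_C_mul, Finsupp.prod_fintype]
      simp
    obtain ⟨c, hc⟩ : ∃ c, listPoly Rp κ m (List.finRange d) q = C c := by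
      refine ⟨_, totalDegree_eq_zero_iff_eq_C.1 ((totalDegree_zero_iff_isHomogeneous _).2 ?_)⟩
      have := (isHomogeneous_listPoly (Rp := Rp) (κ := κ) m (List.finRange d) hq).1
      rwa [hdeg, Nat.sub_eq_zero_of_le hkn] at this
    rw [hmon, map_smul, inner_smul_left, inner_listProd U hU, hdeg, ← polyFun_listPoly, hc,
      Complex.conj_eq_iff_im.2 (hreal m), polyFun_C, ← mul_one (C c), ← smul_eq_C_mul, map_smul,
      inner_smul_right]
    ring
  conv_lhs => rw [p.as_sum]
  rw [map_sum, sum_inner, Finset.sum_congr rfl hterm, pairing, Finset.mul_sum, Finset.sum_mul]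

/-- The bound behind the estimate of the Riesz transforms: summing over all directions,
`∑_j ‖T_j p‖² = 2 ⟨∑_j x_j T_j p, p⟩`, and `∑_j x_j T_j` is the degree plus a bounded operator. -/
lemma norm_dunklPoly_sq_le (U : MvPolynomial (Fin d) ℂ →ₗ[ℂ] H)
    (hU : ∀ j p q, inner ℂ (U (X j * p)) (U q) = (1 / 2 : ℂ) * inner ℂ (U p) (U (dunklPoly Rp κ j q)))
    (hS : ∀ α ∈ Rp, ∀ p, ‖U (reflPoly α p)‖ = ‖U p‖) (hκ : ∀ α ∈ Rp, 0 ≤ κ α)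
    {ι : Type*} {ψ : ι → MvPolynomial (Fin d) ℂ} {deg : ι → ℕ}
    (hdeg : ∀ n, (ψ n).IsHomogeneous (deg n)) (hψ : Orthonormal ℂ fun n => U (ψ n))
    (s : Finset ι) (a : ι → ℂ) (j : Fin d) :
    ‖U (dunklPoly Rp κ j (∑ n ∈ s, a n • ψ n))‖ ^ 2
      ≤ ∑ n ∈ s, (2 * (deg n : ℝ) + 4 * gam Rp κ) * ‖a n‖ ^ 2 := by
  set p := ∑ n ∈ s, a n • ψ n with hp
  have hUp : U p = ∑ n ∈ s, a n • U (ψ n) := by simp [hp]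
  have hnorm : ‖U p‖ ^ 2 = ∑ n ∈ s, ‖a n‖ ^ 2 := by
    rw [← inner_self_eq_norm_sq (𝕜 := ℂ), hUp, hψ.inner_sum, map_sum]
    refine Finset.sum_congr rfl fun n _ => ?_
    rw [mul_comm, RCLike.mul_conj]
    norm_cast
  -- the Euler operator applied to `p`
  have hG : ∑ i, X i * dunklPoly Rp κ i p = ∑ n ∈ s, ((deg n : ℂ) * a n) • ψ n
      + ∑ α ∈ Rp, ((κ α : ℝ) : ℂ) • (p - reflPoly α p) := by
    have h1 : ∑ i, X i * dunklPoly Rp κ i p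
        = ∑ n ∈ s, a n • ∑ i, X i * dunklPoly Rp κ i (ψ n) := by
      simp only [hp, map_sum, map_smul,
        Finset.mul_sum, Finset.smul_sum, mul_smul_comm]
      exact Finset.sum_comm
    rw [h1]
    simp only [sum_X_mul_dunklPoly (hdeg _), smul_add, Finset.sum_add_distrib, smul_smul]
    congr 1
    · exact Finset.sum_congr rfl fun n _ => by rw [mul_comm]
    · simp only [Finset.smul_sum]
      rw [Finset.sum_comm]
      refine Finset.sum_congr rfl fun α _ => ?_
      simp only [hp, map_sum, map_smul,
        smul_sub, Finset.sum_sub_distrib, Finset.smul_sum, smul_smul, mul_comm (a _)]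
  have hsq : ∀ i, ‖U (dunklPoly Rp κ i p)‖ ^ 2
      = 2 * (inner ℂ (U (X i * dunklPoly Rp κ i p)) (U p)).re := by
    intro i
    rw [hU, ← inner_self_eq_norm_sq (𝕜 := ℂ)]
    simp
  have hmain : (inner ℂ (U (∑ n ∈ s, ((deg n : ℂ) * a n) • ψ n)) (U p)).re
      = ∑ n ∈ s, (deg n : ℝ) * ‖a n‖ ^ 2 := by
    rw [map_sum]
    simp only [map_smul]
    rw [hUp, hψ.inner_sum, Complex.re_sum]
    refine Finset.sum_congr rfl fun n _ => ?_
    rw [map_mul, Complex.conj_natCast, mul_assoc, mul_comm (starRingEnd ℂ _), RCLike.mul_conj,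
      ← Complex.ofReal_natCast, Complex.re_ofReal_mul]
    norm_cast
  have hrefl : ∀ α ∈ Rp, (inner ℂ (U (((κ α : ℝ) : ℂ) • (p - reflPoly α p))) (U p)).re
      ≤ κ α * (2 * ‖U p‖ ^ 2) := by
    intro α hα
    rw [map_smul, inner_smul_left, Complex.conj_ofReal, Complex.re_ofReal_mul, map_sub]
    refine mul_le_mul_of_nonneg_left ?_ (hκ α hα)
    calc (inner ℂ (U p - U (reflPoly α p)) (U p)).re
        ≤ ‖U p - U (reflPoly α p)‖ * ‖U p‖ :=
          (Complex.re_le_norm _).trans (norm_inner_le_norm _ _)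
      _ ≤ (‖U p‖ + ‖U (reflPoly α p)‖) * ‖U p‖ := by gcongr; exact norm_sub_le _ _
      _ = 2 * ‖U p‖ ^ 2 := by rw [hS α hα]; ring
  calc ‖U (dunklPoly Rp κ j p)‖ ^ 2 ≤ ∑ i, ‖U (dunklPoly Rp κ i p)‖ ^ 2 :=
        Finset.single_le_sum (f := fun i => ‖U (dunklPoly Rp κ i p)‖ ^ 2)
          (fun i _ => sq_nonneg _) (Finset.mem_univ j)
    _ = 2 * (inner ℂ (U (∑ i, X i * dunklPoly Rp κ i p)) (U p)).re := by
        simp only [hsq]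
        rw [← Finset.mul_sum, map_sum U fun i => X i * dunklPoly Rp κ i p, sum_inner,
          Complex.re_sum]
    _ ≤ 2 * (∑ n ∈ s, (deg n : ℝ) * ‖a n‖ ^ 2 + ∑ α ∈ Rp, κ α * (2 * ‖U p‖ ^ 2)) := by
        rw [hG, map_add, inner_add_left, Complex.add_re, hmain, map_sum, sum_inner, Complex.re_sum]
        gcongr with α hα
        exact hrefl α hα
    _ = ∑ n ∈ s, (2 * (deg n : ℝ) + 4 * gam Rp κ) * ‖a n‖ ^ 2 := by
        rw [← Finset.sum_mul, ← gam, hnorm]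
        simp only [add_mul, Finset.sum_add_distrib, mul_assoc, ← Finset.mul_sum]
        ring

end ExpLaplacian

/-! ### Growth and integrability -/

lemma integrable_exp_neg_mul_sq_norm {b : ℝ} (hb : 0 < b) :
    Integrable fun x : EuclideanSpace ℝ (Fin d) => Real.exp (-b * ‖x‖ ^ 2) := by
  have := (GaussianFourier.integrable_cexp_neg_mul_sq_norm_add (V := EuclideanSpace ℝ (Fin d))
    (b := (b : ℂ)) (by simpa using hb) 0 0).norm
  refine this.congr (Eventually.of_forall fun x => ?_)
  simp only [Complex.norm_exp]
  congr 1
  norm_cast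
  simp

/-- Functions dominated by a polynomial times `e^{a|x| - b|x|²}`, `b > 0`, are integrable. -/
lemma integrable_of_norm_le {E : Type*} [NormedAddCommGroup E] {f : EuclideanSpace ℝ (Fin d) → E}
    (hf : AEStronglyMeasurable f) {C a b : ℝ} {N : ℕ} (hC : 0 ≤ C) (hb : 0 < b)
    (h : ∀ x, ‖f x‖ ≤ C * (1 + ‖x‖) ^ N * Real.exp (a * ‖x‖ - b * ‖x‖ ^ 2)) :
    Integrable f := by
  refine ((integrable_exp_neg_mul_sq_norm (d := d) (half_pos hb)).const_mul
    (C * N.factorial * Real.exp (1 + (a + 1) ^ 2 / (2 * b)))).mono' hf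
    (Eventually.of_forall fun x => (h x).trans ?_)
  have h1 : (1 + ‖x‖) ^ N ≤ N.factorial * Real.exp (1 + ‖x‖) := by
    have := Real.pow_div_factorial_le_exp (1 + ‖x‖) (by positivity) N
    rwa [div_le_iff₀' (by positivity)] at this
  have h2 : (1 + ‖x‖) + (a * ‖x‖ - b * ‖x‖ ^ 2)
      ≤ (1 + (a + 1) ^ 2 / (2 * b)) + (-(b / 2) * ‖x‖ ^ 2) := by
    have : 0 ≤ (a + 1 - b * ‖x‖) ^ 2 / (2 * b) := by positivity
    have h3 : (a + 1 - b * ‖x‖) ^ 2 / (2 * b)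
        = (a + 1) ^ 2 / (2 * b) - (a + 1) * ‖x‖ + b / 2 * ‖x‖ ^ 2 := by
      field_simp
      ring
    linarith
  calc C * (1 + ‖x‖) ^ N * Real.exp (a * ‖x‖ - b * ‖x‖ ^ 2)
      ≤ C * (N.factorial * Real.exp (1 + ‖x‖)) * Real.exp (a * ‖x‖ - b * ‖x‖ ^ 2) := by gcongr
    _ = C * N.factorial * Real.exp ((1 + ‖x‖) + (a * ‖x‖ - b * ‖x‖ ^ 2)) := by
        rw [Real.exp_add (1 + ‖x‖)]; ring
    _ ≤ C * N.factorial * Real.exp ((1 + (a + 1) ^ 2 / (2 * b)) + (-(b / 2) * ‖x‖ ^ 2)) := by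
        gcongr
    _ = _ := by rw [Real.exp_add]; ring

lemma exists_norm_polyFun_le (p : MvPolynomial (Fin d) ℂ) :
    ∃ C N, 0 ≤ C ∧ ∀ x, ‖polyFun p x‖ ≤ C * (1 + ‖x‖) ^ (N : ℕ) := by
  induction p using MvPolynomial.induction_on with
  | C a => exact ⟨‖a‖, 0, norm_nonneg a, fun x => by simp⟩
  | add p q hp hq =>
    obtain ⟨C, N, hC, h⟩ := hp
    obtain ⟨C', N', hC', h'⟩ := hq
    refine ⟨C + C', N + N', by positivity, fun x => ?_⟩
    have h1 : (1 : ℝ) ≤ 1 + ‖x‖ := by simp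
    calc ‖polyFun (p + q) x‖ ≤ ‖polyFun p x‖ + ‖polyFun q x‖ := by
          rw [polyFun_add]; exact norm_add_le _ _
      _ ≤ C * (1 + ‖x‖) ^ N + C' * (1 + ‖x‖) ^ N' := add_le_add (h x) (h' x)
      _ ≤ C * (1 + ‖x‖) ^ (N + N') + C' * (1 + ‖x‖) ^ (N + N') := by
          gcongr <;> first | exact h1 | omega
      _ = _ := by ring
  | mul_X p i hp =>
    obtain ⟨C, N, hC, h⟩ := hp
    refine ⟨C, N + 1, hC, fun x => ?_⟩
    rw [polyFun_mul, norm_mul, polyFun_X, pow_succ, ← mul_assoc]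
    refine mul_le_mul (h x) ?_ (norm_nonneg _) (by positivity)
    rw [Complex.norm_real]
    exact (PiLp.norm_apply_le x i).trans (by simp)

/-! ### Regularized weights -/

section RegWeight

/-- The smooth approximations `∏_{α ∈ R_+} (⟨x, α⟩² + ε)^{κ(α)}`, `ε > 0`, of the weight `w_κ`,
which is the case `ε = 0`. -/
def regWeight (Rp : Finset (EuclideanSpace ℝ (Fin d))) (κ : EuclideanSpace ℝ (Fin d) → ℝ) (ε : ℝ)
    (x : EuclideanSpace ℝ (Fin d)) : ℝ :=
  ∏ α ∈ Rp, ((inner ℝ x α : ℝ) ^ 2 + ε) ^ κ α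

variable {R Rp : Finset (EuclideanSpace ℝ (Fin d))} {κ : EuclideanSpace ℝ (Fin d) → ℝ}

lemma regWeight_zero (x : EuclideanSpace ℝ (Fin d)) : regWeight Rp κ 0 x = weight Rp κ x := by
  refine Finset.prod_congr rfl fun α _ => ?_
  rw [add_zero, ← sq_abs, ← Real.rpow_natCast, ← Real.rpow_mul (abs_nonneg _), real_inner_comm]
  norm_cast

lemma regWeight_nonneg {ε : ℝ} (hε : 0 ≤ ε) (x : EuclideanSpace ℝ (Fin d)) :
    0 ≤ regWeight Rp κ ε x :=
  Finset.prod_nonneg fun α _ => Real.rpow_nonneg (by positivity) _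

lemma continuous_regWeight (hκ : ∀ α ∈ Rp, 0 ≤ κ α) (ε : ℝ) :
    Continuous (regWeight Rp κ ε) :=
  continuous_finsetProd _ fun α hα => Continuous.rpow_const (by fun_prop) fun _ => Or.inr (hκ α hα)

lemma exists_regWeight_le (hκ : ∀ α ∈ Rp, 0 ≤ κ α) (h2 : ∀ α ∈ Rp, inner ℝ α α = (2 : ℝ)) :
    ∃ C N, 0 ≤ C ∧ ∀ ε, 0 ≤ ε → ε ≤ 1 → ∀ x, regWeight Rp κ ε x ≤ C * (1 + ‖x‖) ^ (N : ℕ) := by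
  refine ⟨∏ α ∈ Rp, (2 : ℝ) ^ κ α, ∑ α ∈ Rp, ⌈2 * κ α⌉₊, Finset.prod_nonneg fun α _ => by positivity,
    fun ε hε hε1 x => ?_⟩
  rw [← Finset.prod_pow_eq_pow_sum, ← Finset.prod_mul_distrib]
  refine Finset.prod_le_prod (fun α _ => Real.rpow_nonneg (by positivity) _) fun α hα => ?_
  have hα2 : ‖α‖ ^ 2 = 2 := by rw [← real_inner_self_eq_norm_sq, h2 α hα]
  have h1 : (inner ℝ x α : ℝ) ^ 2 + ε ≤ 2 * (1 + ‖x‖) ^ 2 := by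
    have := abs_real_inner_le_norm x α
    have h3 : (inner ℝ x α : ℝ) ^ 2 ≤ ‖x‖ ^ 2 * 2 := by
      rw [← hα2, ← mul_pow, ← sq_abs]
      gcongr
    nlinarith [norm_nonneg x]
  calc ((inner ℝ x α : ℝ) ^ 2 + ε) ^ κ α ≤ (2 * (1 + ‖x‖) ^ 2) ^ κ α :=
        Real.rpow_le_rpow (by positivity) h1 (hκ α hα)
    _ = 2 ^ κ α * (1 + ‖x‖) ^ (2 * κ α) := by
        rw [Real.mul_rpow (by norm_num) (by positivity), ← Real.rpow_natCast,
          ← Real.rpow_mul (by positivity)]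
        norm_cast
    _ ≤ 2 ^ κ α * (1 + ‖x‖) ^ ⌈2 * κ α⌉₊ := by
        gcongr
        rw [← Real.rpow_natCast]
        exact Real.rpow_le_rpow_of_exponent_le (by simp) (Nat.le_ceil _)

lemma inner_rootReflection_left {β : EuclideanSpace ℝ (Fin d)} (h : inner ℝ β β = (2 : ℝ))
    (x y : EuclideanSpace ℝ (Fin d)) :
    inner ℝ (rootReflection β x) y = (inner ℝ x (rootReflection β y) : ℝ) := by
  rw [← inner_rootReflection h x, rootReflection_rootReflection h]

/-- The regularized weights are invariant under the reflections. -/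
lemma regWeight_rootReflection (hR : IsRootSystem R) (hRp : IsPositiveSubsystem R Rp)
    (hκ : IsMultiplicity R κ) {β : EuclideanSpace ℝ (Fin d)} (hβ : β ∈ R) (ε : ℝ)
    (x : EuclideanSpace ℝ (Fin d)) :
    regWeight Rp κ ε (rootReflection β x) = regWeight Rp κ ε x := by
  rw [regWeight, regWeight, ← prod_positive_rootReflection hR hRp hβ
    (fun α => ((inner ℝ x α : ℝ) ^ 2 + ε) ^ κ α)]
  · refine Finset.prod_congr rfl fun α hα => ?_
    rw [hκ.invariant β hβ α (hRp.subset hα), inner_rootReflection_left (hR.inner_self β hβ)]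
  · intro α hα
    rw [inner_neg_right, neg_sq, hκ.map_neg hR hα]

/-- The Gaussian density `e^{-|x|²}` with respect to the regularized weight. -/
def regDensity (Rp : Finset (EuclideanSpace ℝ (Fin d))) (κ : EuclideanSpace ℝ (Fin d) → ℝ) (ε : ℝ)
    (x : EuclideanSpace ℝ (Fin d)) : ℝ :=
  regWeight Rp κ ε x * Real.exp (-‖x‖ ^ 2)

lemma continuous_regDensity (hκ : ∀ α ∈ Rp, 0 ≤ κ α) (ε : ℝ) :
    Continuous (regDensity Rp κ ε) :=
  (continuous_regWeight hκ ε).mul (by fun_prop)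

lemma regDensity_nonneg {ε : ℝ} (hε : 0 ≤ ε) (x : EuclideanSpace ℝ (Fin d)) :
    0 ≤ regDensity Rp κ ε x :=
  mul_nonneg (regWeight_nonneg hε x) (Real.exp_pos _).le

lemma hasLineDerivAt_regDensity {ε : ℝ} (hε : 0 < ε) (x v : EuclideanSpace ℝ (Fin d)) :
    HasLineDerivAt ℝ (fun x => ((regDensity Rp κ ε x : ℝ) : ℂ))
      ((regDensity Rp κ ε x * (∑ α ∈ Rp, κ α * (2 * inner ℝ x α * inner ℝ v α
        / ((inner ℝ x α) ^ 2 + ε)) - 2 * inner ℝ x v) : ℝ) : ℂ) x v := by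
  have hexp : regDensity Rp κ ε = fun x => Real.exp
      (∑ α ∈ Rp, κ α * Real.log ((inner ℝ x α) ^ 2 + ε) - ‖x‖ ^ 2) := by
    ext y
    rw [regDensity, regWeight, sub_eq_add_neg, Real.exp_add, Real.exp_sum]
    congr 1
    exact Finset.prod_congr rfl fun α _ => by rw [Real.rpow_def_of_pos (by positivity), mul_comm]
  rw [hexp]
  refine HasDerivAt.ofReal_comp (f := fun t : ℝ => Real.exp
    (∑ α ∈ Rp, κ α * Real.log ((inner ℝ (x + t • v) α) ^ 2 + ε) - ‖x + t • v‖ ^ 2)) ?_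
  have hline : HasDerivAt (fun t : ℝ => x + t • v) v 0 := by
    simpa using ((hasDerivAt_id (0 : ℝ)).smul_const v).const_add x
  have hinner : ∀ α : EuclideanSpace ℝ (Fin d),
      HasDerivAt (fun t : ℝ => (inner ℝ (x + t • v) α : ℝ)) (inner ℝ v α) 0 := fun α => by
    simpa using hline.inner ℝ (hasDerivAt_const (0 : ℝ) α)
  have hlog : ∀ α ∈ Rp,
      HasDerivAt (fun t : ℝ => κ α * Real.log ((inner ℝ (x + t • v) α) ^ 2 + ε))
        (κ α * (2 * inner ℝ x α * inner ℝ v α / ((inner ℝ x α) ^ 2 + ε))) 0 := fun α _ => by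
    have := ((((hinner α).pow 2).add_const ε).log
      (add_pos_of_nonneg_of_pos (sq_nonneg _) hε).ne').const_mul (κ α)
    simpa using this
  have := ((HasDerivAt.fun_sum hlog).sub hline.norm_sq).exp
  simpa using this

end RegWeight

/-! ### Integration by parts for the Dunkl operators -/

section IntegrationByParts

variable {R Rp : Finset (EuclideanSpace ℝ (Fin d))} {κ : EuclideanSpace ℝ (Fin d) → ℝ}

lemma exists_regDensity_mul_le (hκ : ∀ α ∈ Rp, 0 ≤ κ α) (h2 : ∀ α ∈ Rp, inner ℝ α α = (2 : ℝ))
    (q : MvPolynomial (Fin d) ℂ) : ∃ g : EuclideanSpace ℝ (Fin d) → ℝ, Integrable g ∧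
      ∀ ε, 0 ≤ ε → ε ≤ 1 → ∀ x, regDensity Rp κ ε x * ‖polyFun q x‖ ≤ g x := by
  obtain ⟨C, N, hC, hw⟩ := exists_regWeight_le hκ h2
  obtain ⟨C', N', hC', hq⟩ := exists_norm_polyFun_le q
  refine ⟨fun x => C * C' * (1 + ‖x‖) ^ (N + N') * Real.exp (-‖x‖ ^ 2), ?_, fun ε h0 h1 x => ?_⟩
  · refine integrable_of_norm_le (a := 0) (b := 1) (C := C * C') (N := N + N')
      (Continuous.aestronglyMeasurable (by fun_prop)) (by positivity) one_pos fun x => ?_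
    rw [Real.norm_of_nonneg (by positivity)]
    simp
  · calc regDensity Rp κ ε x * ‖polyFun q x‖
        ≤ (C * (1 + ‖x‖) ^ N * Real.exp (-‖x‖ ^ 2)) * (C' * (1 + ‖x‖) ^ N') := by
          refine mul_le_mul ?_ (hq x) (norm_nonneg _) (by positivity)
          exact mul_le_mul_of_nonneg_right (hw ε h0 h1 x) (Real.exp_pos _).le
      _ = _ := by simp only [pow_add]; ring

lemma integrable_regDensity_mul (hκ : ∀ α ∈ Rp, 0 ≤ κ α) (h2 : ∀ α ∈ Rp, inner ℝ α α = (2 : ℝ))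
    {ε : ℝ} (h0 : 0 ≤ ε) (h1 : ε ≤ 1) (q : MvPolynomial (Fin d) ℂ)
    {u : EuclideanSpace ℝ (Fin d) → ℝ} (hu : Continuous u) {K : ℝ} (hK : ∀ x, |u x| ≤ K) :
    Integrable fun x => ((regDensity Rp κ ε x : ℝ) : ℂ) * (polyFun q x * ((u x : ℝ) : ℂ)) := by
  obtain ⟨g, hg, hle⟩ := exists_regDensity_mul_le hκ h2 q
  refine (hg.mul_const K).mono' ?_ (Eventually.of_forall fun x => ?_)
  · have := continuous_regDensity hκ ε
    have := continuous_polyFun q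
    exact Continuous.aestronglyMeasurable (by fun_prop)
  · rw [norm_mul, norm_mul, Complex.norm_real, Complex.norm_real, Real.norm_of_nonneg
      (regDensity_nonneg h0 x), ← mul_assoc]
    exact mul_le_mul (hle ε h0 h1 x) (hK x) (abs_nonneg _)
      ((mul_nonneg (regDensity_nonneg h0 x) (norm_nonneg _)).trans (hle ε h0 h1 x))

lemma integrable_regDensity_mul_polyFun (hκ : ∀ α ∈ Rp, 0 ≤ κ α)
    (h2 : ∀ α ∈ Rp, inner ℝ α α = (2 : ℝ)) {ε : ℝ} (h0 : 0 ≤ ε) (h1 : ε ≤ 1)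
    (q : MvPolynomial (Fin d) ℂ) :
    Integrable fun x => ((regDensity Rp κ ε x : ℝ) : ℂ) * polyFun q x := by
  simpa using integrable_regDensity_mul hκ h2 h0 h1 q (u := fun _ => 1) continuous_const
    (K := 1) (by simp)

/-- The regularization `1 / (⟨x, α⟩² + ε)` of `1 / ⟨x, α⟩²`. -/
def regInv (α : EuclideanSpace ℝ (Fin d)) (ε : ℝ) (x : EuclideanSpace ℝ (Fin d)) : ℝ :=
  ((inner ℝ x α : ℝ) ^ 2 + ε)⁻¹

lemma continuous_regInv (α : EuclideanSpace ℝ (Fin d)) {ε : ℝ} (hε : 0 < ε) :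
    Continuous (regInv α ε) :=
  Continuous.inv₀ (by fun_prop) fun x => by positivity

lemma abs_regInv_le (α : EuclideanSpace ℝ (Fin d)) {ε : ℝ} (hε : 0 < ε)
    (x : EuclideanSpace ℝ (Fin d)) : |regInv α ε x| ≤ ε⁻¹ := by
  rw [regInv, abs_of_pos (by positivity)]
  exact inv_anti₀ hε (by nlinarith [sq_nonneg (inner ℝ x α : ℝ)])

/-- The logarithmic derivative in the direction `e_j` of the regularized density, times a
polynomial `p`. -/
lemma integrable_regDensity_deriv_mul (hκ : ∀ α ∈ Rp, 0 ≤ κ α)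
    (h2 : ∀ α ∈ Rp, inner ℝ α α = (2 : ℝ)) {ε : ℝ} (h0 : 0 < ε) (h1 : ε ≤ 1) (j : Fin d)
    (p : MvPolynomial (Fin d) ℂ) :
    Integrable fun x => ((regDensity Rp κ ε x : ℝ) : ℂ)
      * ((∑ α ∈ Rp, ((κ α * α j : ℝ) : ℂ) * (2 * polyFun (linForm α * p) x * (regInv α ε x : ℂ)))
        - 2 * polyFun (X j * p) x) := by
  simp only [mul_sub, Finset.mul_sum]
  refine (integrable_finsetSum _ fun α _ => ?_).sub ?_
  · refine ((integrable_regDensity_mul hκ h2 h0.le h1 (linForm α * p) (continuous_regInv α h0)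
      (abs_regInv_le α h0)).const_mul (2 * ((κ α * α j : ℝ) : ℂ))).congr
      (Eventually.of_forall fun x => ?_)
    simp only
    ring
  · refine ((integrable_regDensity_mul_polyFun hκ h2 h0.le h1 (X j * p)).const_mul 2).congr
      (Eventually.of_forall fun x => ?_)
    simp only
    ring

lemma integral_regDensity_pderiv (hκ : ∀ α ∈ Rp, 0 ≤ κ α)
    (h2 : ∀ α ∈ Rp, inner ℝ α α = (2 : ℝ)) {ε : ℝ} (h0 : 0 < ε) (h1 : ε ≤ 1) (j : Fin d)
    (p : MvPolynomial (Fin d) ℂ) :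
    ∫ x, ((regDensity Rp κ ε x : ℝ) : ℂ) * polyFun (pderiv j p) x
      = -∫ x, ((regDensity Rp κ ε x : ℝ) : ℂ)
      * ((∑ α ∈ Rp, ((κ α * α j : ℝ) : ℂ) * (2 * polyFun (linForm α * p) x * (regInv α ε x : ℂ)))
        - 2 * polyFun (X j * p) x) := by
  have hderiv : ∀ x, ((regDensity Rp κ ε x * (∑ α ∈ Rp, κ α * (2 * inner ℝ x α
      * inner ℝ (EuclideanSpace.single j (1 : ℝ)) α / ((inner ℝ x α) ^ 2 + ε))
      - 2 * inner ℝ x (EuclideanSpace.single j (1 : ℝ))) : ℝ) : ℂ) * polyFun p x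
      = ((regDensity Rp κ ε x : ℝ) : ℂ) * ((∑ α ∈ Rp, ((κ α * α j : ℝ) : ℂ)
        * (2 * polyFun (linForm α * p) x * (regInv α ε x : ℂ))) - 2 * polyFun (X j * p) x) := by
    intro x
    simp only [EuclideanSpace.inner_single_left, EuclideanSpace.inner_single_right, regInv,
      polyFun_mul, polyFun_linForm, polyFun_X, map_one, one_mul, RCLike.conj_to_real,
      Complex.ofReal_mul, Complex.ofReal_sub, Complex.ofReal_sum, Complex.ofReal_inv,
      Complex.ofReal_ofNat, div_eq_mul_inv]
    rw [mul_assoc, sub_mul, Finset.sum_mul]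
    congr 2
    · exact Finset.sum_congr rfl fun α _ => by ring
    · ring
  have := integral_bilinear_hasLineDerivAt_right_eq_neg_left_of_integrable
    (μ := (volume : Measure (EuclideanSpace ℝ (Fin d)))) (B := ContinuousLinearMap.mul ℝ ℂ)
    (v := EuclideanSpace.single j (1 : ℝ)) (f := fun x => ((regDensity Rp κ ε x : ℝ) : ℂ))
    (g := polyFun p) (g' := polyFun (pderiv j p))
    (f' := fun x => ((regDensity Rp κ ε x * (∑ α ∈ Rp, κ α * (2 * inner ℝ x α
      * inner ℝ (EuclideanSpace.single j (1 : ℝ)) α / ((inner ℝ x α) ^ 2 + ε))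
      - 2 * inner ℝ x (EuclideanSpace.single j (1 : ℝ))) : ℝ) : ℂ))
    ?_ ?_ ?_ ?_ ?_
  · simp only [ContinuousLinearMap.mul_apply', hderiv] at this
    exact this
  · simp only [ContinuousLinearMap.mul_apply', hderiv]
    exact integrable_regDensity_deriv_mul hκ h2 h0 h1 j p
  · exact integrable_regDensity_mul_polyFun hκ h2 h0.le h1 _
  · exact integrable_regDensity_mul_polyFun hκ h2 h0.le h1 _
  · exact fun x _ => hasLineDerivAt_regDensity h0 x _
  · intro x _
    rw [← fderiv_polyFun_single]
    exact (differentiable_polyFun p x).hasFDerivAt.hasLineDerivAt _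

/-- The reflection `σ_α` as a linear isometry. -/
def reflIsometry {α : EuclideanSpace ℝ (Fin d)} (h : inner ℝ α α = (2 : ℝ)) :
    EuclideanSpace ℝ (Fin d) ≃ₗᵢ[ℝ] EuclideanSpace ℝ (Fin d) where
  toFun := rootReflection α
  invFun := rootReflection α
  left_inv := rootReflection_rootReflection h
  right_inv := rootReflection_rootReflection h
  map_add' x y := by simp only [← reflCLM_apply, map_add]
  map_smul' c x := by simp only [← reflCLM_apply, map_smul, RingHom.id_apply]
  norm_map' := norm_rootReflection h

lemma integral_comp_rootReflection {E : Type*} [NormedAddCommGroup E] [NormedSpace ℝ E]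
    {α : EuclideanSpace ℝ (Fin d)} (h : inner ℝ α α = (2 : ℝ)) (f : EuclideanSpace ℝ (Fin d) → E) :
    ∫ x, f (rootReflection α x) = ∫ x, f x :=
  (reflIsometry h).measurePreserving.integral_comp
    (reflIsometry h).toHomeomorph.measurableEmbedding f

/-- Functions that change sign under a reflection have integral zero. -/
lemma integral_regDensity_antisymm (hR : IsRootSystem R) (hRp : IsPositiveSubsystem R Rp)
    (hκ : IsMultiplicity R κ) {α : EuclideanSpace ℝ (Fin d)} (hα : α ∈ R) (ε : ℝ)
    (p : MvPolynomial (Fin d) ℂ) (hp : reflPoly α p = p) :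
    ∫ x, ((regDensity Rp κ ε x : ℝ) : ℂ) * (polyFun (linForm α * p) x * (regInv α ε x : ℂ)) = 0 := by
  have h2 := hR.inner_self α hα
  rw [← self_eq_neg, ← integral_neg, ← integral_comp_rootReflection h2]
  congr 1
  ext x
  have hinner : (inner ℝ (rootReflection α x) α : ℝ) = -inner ℝ x α := by
    rw [inner_rootReflection_left h2, rootReflection_self h2, inner_neg_right]
  have hpx : polyFun p (rootReflection α x) = polyFun p x := by
    rw [← polyFun_reflPoly, hp]
  simp only [regDensity, regWeight_rootReflection hR hRp hκ hα, norm_rootReflection h2, regInv,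
    polyFun_mul, polyFun_linForm, hinner, hpx, neg_sq, Complex.ofReal_neg]
  ring

variable (Rp κ) in
/-- The polynomial `T_j p · q + p · T_j q - 2 x_j p q`, the Dunkl divergence of `p q e^{-|x|²}`
divided by `e^{-|x|²}`. -/
def dunklDiv (j : Fin d) (p q : MvPolynomial (Fin d) ℂ) : MvPolynomial (Fin d) ℂ :=
  dunklPoly Rp κ j p * q + p * dunklPoly Rp κ j q - C 2 * (X j * (p * q))

/-- Integration by parts for the regularized weight. The reflection terms are symmetrized with
`integral_regDensity_antisymm`; this is what makes the singular factor `1 / ⟨x, α⟩` of the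
logarithmic derivative of the weight appear only as the bounded factor
`⟨x, α⟩² / (⟨x, α⟩² + ε)`. -/
lemma integral_regDensity_dunklDiv (hR : IsRootSystem R) (hRp : IsPositiveSubsystem R Rp)
    (hκ : IsMultiplicity R κ) {ε : ℝ} (h0 : 0 < ε) (h1 : ε ≤ 1) (j : Fin d)
    (p q : MvPolynomial (Fin d) ℂ) :
    ∫ x, ((regDensity Rp κ ε x : ℝ) : ℂ) * (polyFun (pderiv j (p * q) - C 2 * (X j * (p * q))) x
      + ∑ α ∈ Rp, ((κ α * α j : ℝ) : ℂ) * (polyFun (divDiff α p * q + p * divDiff α q) x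
        * (((inner ℝ x α) ^ 2 * regInv α ε x : ℝ) : ℂ))) = 0 := by
  have hκ0 : ∀ α ∈ Rp, 0 ≤ κ α := fun α hα => hκ.nonneg α (hRp.subset hα)
  have h2 : ∀ α ∈ Rp, inner ℝ α α = (2 : ℝ) := fun α hα => hR.inner_self α (hRp.subset hα)
  set N : EuclideanSpace ℝ (Fin d) → MvPolynomial (Fin d) ℂ :=
    fun α => reflPoly α p * q + p * reflPoly α q with hN
  have hsym : ∀ α ∈ Rp, reflPoly α (N α) = N α := fun α hα => by
    simp only [hN, map_add, map_mul, reflPoly_reflPoly (h2 α hα)]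
    ring
  have hdiv : ∀ α x, polyFun (divDiff α p * q + p * divDiff α q) x * ((inner ℝ x α : ℝ) : ℂ)
      = 2 * polyFun (p * q) x - polyFun (N α) x := by
    intro α x
    have e1 := congrArg (fun r => polyFun r x) (linForm_mul_divDiff α p)
    have e2 := congrArg (fun r => polyFun r x) (linForm_mul_divDiff α q)
    simp only [polyFun_mul, polyFun_linForm, polyFun_sub] at e1 e2
    simp only [hN, polyFun_add, polyFun_mul]
    linear_combination polyFun q x * e1 + polyFun p x * e2
  have hpt : ∀ x, ((regDensity Rp κ ε x : ℝ) : ℂ)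
      * (polyFun (pderiv j (p * q) - C 2 * (X j * (p * q))) x
      + ∑ α ∈ Rp, ((κ α * α j : ℝ) : ℂ) * (polyFun (divDiff α p * q + p * divDiff α q) x
        * (((inner ℝ x α) ^ 2 * regInv α ε x : ℝ) : ℂ)))
      = ((regDensity Rp κ ε x : ℝ) : ℂ) * polyFun (pderiv j (p * q)) x
        + ((regDensity Rp κ ε x : ℝ) : ℂ) * ((∑ α ∈ Rp, ((κ α * α j : ℝ) : ℂ)
          * (2 * polyFun (linForm α * (p * q)) x * (regInv α ε x : ℂ)))
          - 2 * polyFun (X j * (p * q)) x)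
        - ∑ α ∈ Rp, ((κ α * α j : ℝ) : ℂ) * (((regDensity Rp κ ε x : ℝ) : ℂ)
          * (polyFun (linForm α * N α) x * (regInv α ε x : ℂ))) := by
    intro x
    have hs : ∀ α ∈ Rp, ((κ α * α j : ℝ) : ℂ) * (polyFun (divDiff α p * q + p * divDiff α q) x
        * (((inner ℝ x α) ^ 2 * regInv α ε x : ℝ) : ℂ))
        = ((κ α * α j : ℝ) : ℂ) * (2 * polyFun (linForm α * (p * q)) x * (regInv α ε x : ℂ))
          - ((κ α * α j : ℝ) : ℂ) * (polyFun (linForm α * N α) x * (regInv α ε x : ℂ)) := by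
      intro α _
      rw [polyFun_mul (linForm α), polyFun_mul (linForm α), polyFun_linForm, Complex.ofReal_mul _
        (regInv α ε x), Complex.ofReal_pow]
      linear_combination ((κ α * α j : ℝ) : ℂ) * ((inner ℝ x α : ℝ) : ℂ) * (regInv α ε x : ℂ)
        * hdiv α x
    rw [Finset.sum_congr rfl hs, Finset.sum_sub_distrib, polyFun_sub, polyFun_mul (C 2), polyFun_C]
    simp only [mul_left_comm (((κ _ * _ : ℝ) : ℂ)) ((regDensity Rp κ ε x : ℝ) : ℂ),
      ← Finset.mul_sum]
    ring
  have hint : ∀ α ∈ Rp, Integrable fun x => ((κ α * α j : ℝ) : ℂ) * (((regDensity Rp κ ε x : ℝ) : ℂ)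
      * (polyFun (linForm α * N α) x * (regInv α ε x : ℂ))) := fun α _ =>
    (integrable_regDensity_mul hκ0 h2 h0.le h1 _ (continuous_regInv α h0)
      (abs_regInv_le α h0)).const_mul _
  have hA := integrable_regDensity_mul_polyFun hκ0 h2 h0.le h1 (pderiv j (p * q))
  have hB := integrable_regDensity_deriv_mul hκ0 h2 h0 h1 j (p * q)
  simp only [hpt]
  rw [integral_sub (by exact hA.add hB) (integrable_finsetSum _ hint),
    integral_finsetSum _ hint, integral_add hA hB, integral_regDensity_pderiv hκ0 h2 h0 h1, neg_add_cancel, zero_sub,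
    neg_eq_zero]
  refine Finset.sum_eq_zero fun α hα => ?_
  rw [integral_const_mul, integral_regDensity_antisymm hR hRp hκ (hRp.subset hα) ε _ (hsym α hα),
    mul_zero]

lemma tendsto_regDensity (hκ : ∀ α ∈ Rp, 0 ≤ κ α) (x : EuclideanSpace ℝ (Fin d)) :
    Tendsto (fun ε => regDensity Rp κ ε x) (𝓝 0) (𝓝 (regDensity Rp κ 0 x)) := by
  refine Tendsto.mul_const _ (tendsto_finsetProd _ fun α hα => ?_)
  refine Tendsto.rpow_const ?_ (Or.inr (hκ α hα))
  exact (continuous_const.add continuous_id).tendsto 0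

/-- On the hyperplane orthogonal to `α` either `κ(α)` or the weight vanishes, so that the limit as
`ε → 0` holds at every point. -/
lemma tendsto_regDensity_mul (hκ : ∀ α ∈ Rp, 0 ≤ κ α) {α : EuclideanSpace ℝ (Fin d)} (hα : α ∈ Rp)
    (x : EuclideanSpace ℝ (Fin d)) :
    Tendsto (fun ε => regDensity Rp κ ε x * κ α * ((inner ℝ x α) ^ 2 * regInv α ε x)) (𝓝 0)
      (𝓝 (regDensity Rp κ 0 x * κ α)) := by
  by_cases h : (inner ℝ x α : ℝ) = 0
  · have : regDensity Rp κ 0 x * κ α = 0 := by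
      by_cases h' : κ α = 0
      · simp [h']
      · have : regWeight Rp κ 0 x = 0 :=
          Finset.prod_eq_zero hα (by simp [h, Real.zero_rpow h'])
        simp [regDensity, this]
    simp [h, this]
  · have hlim : Tendsto (fun ε => (inner ℝ x α : ℝ) ^ 2 * regInv α ε x) (𝓝 0) (𝓝 1) := by
      have : Tendsto (fun ε => (inner ℝ x α : ℝ) ^ 2 * ((inner ℝ x α : ℝ) ^ 2 + ε)⁻¹) (𝓝 0)
          (𝓝 ((inner ℝ x α : ℝ) ^ 2 * ((inner ℝ x α : ℝ) ^ 2 + 0)⁻¹)) :=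
        (((continuous_const.add continuous_id).tendsto 0).inv₀ (by simpa using h)).const_mul _
      rwa [add_zero, mul_inv_cancel₀ (by positivity)] at this
    simpa using ((tendsto_regDensity hκ x).mul_const (κ α)).mul hlim

lemma tendsto_integral_regDensity (hκ : ∀ α ∈ Rp, 0 ≤ κ α)
    (h2 : ∀ α ∈ Rp, inner ℝ α α = (2 : ℝ)) (A : MvPolynomial (Fin d) ℂ)
    (K : EuclideanSpace ℝ (Fin d) → MvPolynomial (Fin d) ℂ) (j : Fin d) {ε : ℕ → ℝ}
    (hpos : ∀ n, 0 < ε n) (hle1 : ∀ n, ε n ≤ 1) (hε : Tendsto ε atTop (𝓝 0)) :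
    Tendsto (fun n => ∫ x, ((regDensity Rp κ (ε n) x : ℝ) : ℂ) * (polyFun A x
        + ∑ α ∈ Rp, ((κ α * α j : ℝ) : ℂ) * (polyFun (K α) x
          * (((inner ℝ x α) ^ 2 * regInv α (ε n) x : ℝ) : ℂ)))) atTop
      (𝓝 (∫ x, ((regDensity Rp κ 0 x : ℝ) : ℂ)
        * (polyFun A x + ∑ α ∈ Rp, ((κ α * α j : ℝ) : ℂ) * polyFun (K α) x))) := by
  obtain ⟨gA, hgA, hleA⟩ := exists_regDensity_mul_le hκ h2 A
  choose gK hgK hleK using fun α => exists_regDensity_mul_le hκ h2 (K α)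
  refine tendsto_integral_of_dominated_convergence
    (fun x => gA x + ∑ α ∈ Rp, |κ α * α j| * gK α x) (fun n => ?_)
    (hgA.add (integrable_finsetSum _ fun α _ => (hgK α).const_mul _))
    (fun n => Eventually.of_forall fun x => ?_) (Eventually.of_forall fun x => ?_)
  · refine Continuous.aestronglyMeasurable ((Complex.continuous_ofReal.comp
      (continuous_regDensity hκ _)).mul ((continuous_polyFun A).add
      (continuous_finsetSum _ fun α _ => continuous_const.mul ((continuous_polyFun (K α)).mul
      (Complex.continuous_ofReal.comp (Continuous.mul ?_ (continuous_regInv α (hpos n))))))))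
    fun_prop
  · rw [mul_add, Finset.mul_sum]
    refine (norm_add_le _ _).trans (add_le_add ?_ ((norm_sum_le _ _).trans
      (Finset.sum_le_sum fun α _ => ?_)))
    · rw [norm_mul, Complex.norm_real, Real.norm_of_nonneg (regDensity_nonneg (hpos n).le x)]
      exact hleA _ (hpos n).le (hle1 n) x
    · have hb : |(inner ℝ x α : ℝ) ^ 2 * regInv α (ε n) x| ≤ 1 := by
        have := hpos n
        rw [regInv, ← div_eq_mul_inv, abs_of_nonneg (by positivity), div_le_one (by positivity)]
        linarith
      have hK := hleK α _ (hpos n).le (hle1 n) x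
      have h0 : 0 ≤ regDensity Rp κ (ε n) x * ‖polyFun (K α) x‖ :=
        mul_nonneg (regDensity_nonneg (hpos n).le x) (norm_nonneg _)
      have heq : ‖((regDensity Rp κ (ε n) x : ℝ) : ℂ) * (((κ α * α j : ℝ) : ℂ) * (polyFun (K α) x
          * (((inner ℝ x α) ^ 2 * regInv α (ε n) x : ℝ) : ℂ)))‖
          = |κ α * α j| * ((regDensity Rp κ (ε n) x * ‖polyFun (K α) x‖)
            * |(inner ℝ x α : ℝ) ^ 2 * regInv α (ε n) x|) := by
        rw [norm_mul, norm_mul, norm_mul, Complex.norm_real, Complex.norm_real, Complex.norm_real,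
          Real.norm_of_nonneg (regDensity_nonneg (hpos n).le x), Real.norm_eq_abs, Real.norm_eq_abs]
        ring
      rw [heq]
      refine mul_le_mul_of_nonneg_left ?_ (abs_nonneg _)
      exact (mul_le_of_le_one_right h0 hb).trans hK
  · simp only [mul_add, Finset.mul_sum]
    refine Tendsto.add (Tendsto.mul_const _ ?_) (tendsto_finsetSum _ fun α hα => ?_)
    · exact (Complex.continuous_ofReal.tendsto _).comp ((tendsto_regDensity hκ x).comp hε)
    · have := ((Complex.continuous_ofReal.tendsto _).comp
        ((tendsto_regDensity_mul hκ hα x).comp hε)).mul_const (((α j : ℝ) : ℂ) * polyFun (K α) x)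
      have e : ((regDensity Rp κ 0 x : ℝ) : ℂ) * (((κ α * α j : ℝ) : ℂ) * polyFun (K α) x)
          = ((regDensity Rp κ 0 x * κ α : ℝ) : ℂ) * (((α j : ℝ) : ℂ) * polyFun (K α) x) := by
        push_cast
        ring
      rw [e]
      refine this.congr fun n => ?_
      simp only [Function.comp, Complex.ofReal_mul]
      ring

lemma polyFun_dunklDiv (j : Fin d) (p q : MvPolynomial (Fin d) ℂ) (x : EuclideanSpace ℝ (Fin d)) :
    polyFun (dunklDiv Rp κ j p q) x = polyFun (pderiv j (p * q) - C 2 * (X j * (p * q))) x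
      + ∑ α ∈ Rp, ((κ α * α j : ℝ) : ℂ) * polyFun (divDiff α p * q + p * divDiff α q) x := by
  have e : ∀ α : EuclideanSpace ℝ (Fin d), polyFun p x * (((κ α * α j : ℝ) : ℂ)
      * polyFun (divDiff α q) x) = ((κ α * α j : ℝ) : ℂ) * (polyFun p x
      * polyFun (divDiff α q) x) := fun α => by ring
  simp only [dunklDiv, dunklPoly_apply, polyFun_sub, polyFun_add, polyFun_mul, polyFun_sum,
    polyFun_smul, Derivation.leibniz, smul_eq_mul, mul_add, Finset.sum_add_distrib, add_mul,
    Finset.sum_mul, Finset.mul_sum, e, mul_assoc]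
  ring

/-- Integration by parts for the Dunkl operators against the Gaussian `e^{-|x|²} dμ_κ`. -/
lemma integral_dunklDiv (hR : IsRootSystem R) (hRp : IsPositiveSubsystem R Rp)
    (hκ : IsMultiplicity R κ) (j : Fin d) (p q : MvPolynomial (Fin d) ℂ) :
    ∫ x, ((regDensity Rp κ 0 x : ℝ) : ℂ) * polyFun (dunklDiv Rp κ j p q) x = 0 := by
  have hpos : ∀ n : ℕ, 0 < 1 / ((n : ℝ) + 1) := fun n => by positivity
  have hle1 : ∀ n : ℕ, 1 / ((n : ℝ) + 1) ≤ 1 := fun n => by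
    rw [div_le_one (by positivity)]; simp
  have hlim := tendsto_integral_regDensity
    (fun α hα => hκ.nonneg α (hRp.subset hα)) (fun α hα => hR.inner_self α (hRp.subset hα))
    (pderiv j (p * q) - C 2 * (X j * (p * q))) (fun α => divDiff α p * q + p * divDiff α q) j hpos
    hle1 tendsto_one_div_add_atTop_nhds_zero_nat
  simp only [integral_regDensity_dunklDiv hR hRp hκ (hpos _) (hle1 _),
    ← polyFun_dunklDiv] at hlim
  exact tendsto_nhds_unique hlim tendsto_const_nhds

end IntegrationByParts

/-! ### Polynomials times the Gaussian in `L²(μ_κ)` -/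

/-- The polynomial with conjugated coefficients. -/
def conjPoly (p : MvPolynomial (Fin d) ℂ) : MvPolynomial (Fin d) ℂ :=
  map (starRingEnd ℂ) p

@[simp] lemma polyFun_conjPoly (p : MvPolynomial (Fin d) ℂ) (x : EuclideanSpace ℝ (Fin d)) :
    polyFun (conjPoly p) x = (starRingEnd ℂ) (polyFun p x) := by
  induction p using MvPolynomial.induction_on with
  | C a => simp [conjPoly]
  | add p q hp hq => simp_all [conjPoly]
  | mul_X p i hp => simp_all [conjPoly]

lemma divDiff_conjPoly (α : EuclideanSpace ℝ (Fin d)) (p : MvPolynomial (Fin d) ℂ) :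
    divDiff α (conjPoly p) = conjPoly (divDiff α p) := by
  refine polyFun_injective (funext fun x => ?_)
  rw [polyFun_conjPoly, polyFun_divDiff, polyFun_divDiff]
  unfold diffQuot
  split_ifs
  · simp only [fderiv_polyFun, map_sum, map_mul, Complex.conj_ofReal]
    refine Finset.sum_congr rfl fun i _ => ?_
    rw [← polyFun_conjPoly, conjPoly, pderiv_map, ← conjPoly]
  · simp

section Gauss

variable {R Rp : Finset (EuclideanSpace ℝ (Fin d))} {κ : EuclideanSpace ℝ (Fin d) → ℝ}

lemma dunklPoly_conjPoly (j : Fin d) (p : MvPolynomial (Fin d) ℂ) :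
    dunklPoly Rp κ j (conjPoly p) = conjPoly (dunklPoly Rp κ j p) := by
  refine polyFun_injective (funext fun x => ?_)
  have : pderiv j (conjPoly p) = conjPoly (pderiv j p) := by simp [conjPoly, pderiv_map]
  simp only [dunklPoly_apply, divDiff_conjPoly, this, polyFun_conjPoly, polyFun_add, polyFun_sum,
    polyFun_smul, map_add, map_sum, map_mul, Complex.conj_ofReal]

lemma continuous_weight (hκ : ∀ α ∈ Rp, 0 ≤ κ α) : Continuous (weight Rp κ) :=
  (continuous_regWeight hκ 0).congr regWeight_zero

lemma weight_nonneg (x : EuclideanSpace ℝ (Fin d)) : 0 ≤ weight Rp κ x :=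
  regWeight_zero (Rp := Rp) (κ := κ) x ▸ regWeight_nonneg le_rfl x

lemma integral_mu (hκ : ∀ α ∈ Rp, 0 ≤ κ α) {E : Type*} [NormedAddCommGroup E] [NormedSpace ℝ E]
    (f : EuclideanSpace ℝ (Fin d) → E) : ∫ x, f x ∂(mu Rp κ) = ∫ x, weight Rp κ x • f x := by
  rw [mu, integral_withDensity_eq_integral_toReal_smul
    (continuous_weight hκ).measurable.ennreal_ofReal (Eventually.of_forall fun x => by simp)]
  simp only [ENNReal.toReal_ofReal (weight_nonneg _)]

lemma integrable_mu_iff (hκ : ∀ α ∈ Rp, 0 ≤ κ α) {E : Type*} [NormedAddCommGroup E]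
    [NormedSpace ℝ E] (f : EuclideanSpace ℝ (Fin d) → E) :
    Integrable f (mu Rp κ) ↔ Integrable fun x => weight Rp κ x • f x := by
  rw [mu, integrable_withDensity_iff_integrable_smul'
    (continuous_weight hκ).measurable.ennreal_ofReal (Eventually.of_forall fun x => by simp)]
  simp only [ENNReal.toReal_ofReal (weight_nonneg _)]

lemma exp_half_mul_exp_half (x : EuclideanSpace ℝ (Fin d)) :
    Real.exp (-‖x‖ ^ 2 / 2) * Real.exp (-‖x‖ ^ 2 / 2) = Real.exp (-‖x‖ ^ 2) := by
  rw [← Real.exp_add]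
  congr 1
  ring

/-- The function `e^{-|x|²/2} p(x)`. -/
def gaussFun (p : MvPolynomial (Fin d) ℂ) (x : EuclideanSpace ℝ (Fin d)) : ℂ :=
  ((Real.exp (-‖x‖ ^ 2 / 2) : ℝ) : ℂ) * polyFun p x

lemma continuous_gaussFun (p : MvPolynomial (Fin d) ℂ) : Continuous (gaussFun p) :=
  Continuous.mul (by fun_prop) (continuous_polyFun p)

lemma memLp_gaussFun (hκ : ∀ α ∈ Rp, 0 ≤ κ α) (h2 : ∀ α ∈ Rp, inner ℝ α α = (2 : ℝ))
    (p : MvPolynomial (Fin d) ℂ) : MemLp (gaussFun p) 2 (mu Rp κ) := by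
  rw [memLp_two_iff_integrable_sq_norm (continuous_gaussFun p).aestronglyMeasurable,
    integrable_mu_iff hκ]
  refine (integrable_regDensity_mul_polyFun hκ h2 le_rfl zero_le_one (p * p)).norm.congr
    (Eventually.of_forall fun x => ?_)
  simp only [norm_mul, polyFun_mul, Complex.norm_real, gaussFun, smul_eq_mul,
    Real.norm_of_nonneg (regDensity_nonneg le_rfl x), Real.norm_of_nonneg (Real.exp_pos _).le]
  rw [regDensity, regWeight_zero, ← exp_half_mul_exp_half]
  ring

/-- The map `p ↦ e^{-|x|²/2} p` from the polynomials to `L²(μ_κ)`. -/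
def gaussLp (hκ : ∀ α ∈ Rp, 0 ≤ κ α) (h2 : ∀ α ∈ Rp, inner ℝ α α = (2 : ℝ)) :
    MvPolynomial (Fin d) ℂ →ₗ[ℂ] Lp ℂ 2 (mu Rp κ) where
  toFun p := (memLp_gaussFun hκ h2 p).toLp
  map_add' p q := by
    rw [← MemLp.toLp_add, MemLp.toLp_eq_toLp_iff]
    refine Eventually.of_forall fun x => ?_
    simp [gaussFun, mul_add]
  map_smul' c p := by
    rw [RingHom.id_apply, ← MemLp.toLp_const_smul, MemLp.toLp_eq_toLp_iff]
    refine Eventually.of_forall fun x => ?_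
    simp [gaussFun, mul_left_comm]

lemma gaussLp_apply (hκ : ∀ α ∈ Rp, 0 ≤ κ α) (h2 : ∀ α ∈ Rp, inner ℝ α α = (2 : ℝ))
    (p : MvPolynomial (Fin d) ℂ) : gaussLp hκ h2 p = (memLp_gaussFun hκ h2 p).toLp :=
  rfl

lemma inner_gaussLp_eq_integral_mu (hκ : ∀ α ∈ Rp, 0 ≤ κ α)
    (h2 : ∀ α ∈ Rp, inner ℝ α α = (2 : ℝ)) (p q : MvPolynomial (Fin d) ℂ) :
    inner ℂ (gaussLp hκ h2 p) (gaussLp hκ h2 q)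
      = ∫ x, gaussFun q x * (starRingEnd ℂ) (gaussFun p x) ∂(mu Rp κ) := by
  rw [L2.inner_def]
  refine integral_congr_ae ?_
  filter_upwards [(memLp_gaussFun hκ h2 p).coeFn_toLp, (memLp_gaussFun hκ h2 q).coeFn_toLp]
    with x h1 h2
  rw [gaussLp_apply, gaussLp_apply, h1, h2, RCLike.inner_apply]

lemma inner_gaussLp (hκ : ∀ α ∈ Rp, 0 ≤ κ α) (h2 : ∀ α ∈ Rp, inner ℝ α α = (2 : ℝ))
    (p q : MvPolynomial (Fin d) ℂ) : inner ℂ (gaussLp hκ h2 p) (gaussLp hκ h2 q)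
      = ∫ x, ((regDensity Rp κ 0 x : ℝ) : ℂ) * polyFun (conjPoly p * q) x := by
  rw [inner_gaussLp_eq_integral_mu, integral_mu hκ]
  congr 1
  ext x
  simp only [gaussFun, map_mul, Complex.conj_ofReal, polyFun_mul,
    polyFun_conjPoly, Complex.real_smul, regDensity, regWeight_zero, ← exp_half_mul_exp_half]
  push_cast
  ring

lemma inner_gaussLp_X_mul (hκ : ∀ α ∈ Rp, 0 ≤ κ α) (h2 : ∀ α ∈ Rp, inner ℝ α α = (2 : ℝ))
    (j : Fin d) (p q : MvPolynomial (Fin d) ℂ) :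
    inner ℂ (gaussLp hκ h2 (X j * p)) (gaussLp hκ h2 q)
      = inner ℂ (gaussLp hκ h2 p) (gaussLp hκ h2 (X j * q)) := by
  rw [inner_gaussLp, inner_gaussLp]
  congr 1
  ext x
  simp only [polyFun_mul, polyFun_conjPoly, polyFun_X, map_mul, Complex.conj_ofReal]
  ring

lemma inner_gaussLp_dunklPoly (hR : IsRootSystem R) (hRp : IsPositiveSubsystem R Rp)
    (hκ : IsMultiplicity R κ) (hκ0 : ∀ α ∈ Rp, 0 ≤ κ α) (h2 : ∀ α ∈ Rp, inner ℝ α α = (2 : ℝ))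
    (j : Fin d) (p q : MvPolynomial (Fin d) ℂ) :
    inner ℂ (gaussLp hκ0 h2 (dunklPoly Rp κ j p)) (gaussLp hκ0 h2 q)
      + inner ℂ (gaussLp hκ0 h2 p) (gaussLp hκ0 h2 (dunklPoly Rp κ j q))
      = 2 * inner ℂ (gaussLp hκ0 h2 p) (gaussLp hκ0 h2 (X j * q)) := by
  have hint := integrable_regDensity_mul_polyFun hκ0 h2 le_rfl zero_le_one
  rw [← sub_eq_zero, ← integral_dunklDiv hR hRp hκ j (conjPoly p) q, inner_gaussLp, inner_gaussLp,
    inner_gaussLp, ← integral_add (hint _) (hint _), ← integral_const_mul,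
    ← integral_sub (by exact (hint _).add (hint _)) ((hint _).const_mul _)]
  congr 1
  ext x
  simp only [dunklDiv, dunklPoly_conjPoly, polyFun_sub, polyFun_add, polyFun_mul, polyFun_C,
    polyFun_X]
  ring

lemma norm_gaussLp_reflPoly (hR : IsRootSystem R) (hRp : IsPositiveSubsystem R Rp)
    (hκ : IsMultiplicity R κ) (hκ0 : ∀ α ∈ Rp, 0 ≤ κ α) (h2 : ∀ α ∈ Rp, inner ℝ α α = (2 : ℝ))
    {α : EuclideanSpace ℝ (Fin d)} (hα : α ∈ R) (p : MvPolynomial (Fin d) ℂ) :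
    ‖gaussLp hκ0 h2 (reflPoly α p)‖ = ‖gaussLp hκ0 h2 p‖ := by
  rw [← pow_left_inj₀ (norm_nonneg _) (norm_nonneg _) two_ne_zero,
    ← inner_self_eq_norm_sq (𝕜 := ℂ), ← inner_self_eq_norm_sq (𝕜 := ℂ)]
  congr 1
  rw [inner_gaussLp, inner_gaussLp, ← integral_comp_rootReflection (hR.inner_self α hα)]
  congr 1
  ext x
  simp only [regDensity, regWeight_rootReflection hR hRp hκ hα,
    norm_rootReflection (hR.inner_self α hα), polyFun_mul, polyFun_conjPoly, polyFun_reflPoly,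
    rootReflection_rootReflection (hR.inner_self α hα)]

/-! ### The map `p ↦ e^{-|x|²/2} e^{-Δ/4} p` -/

/-- The map `p ↦ e^{-|x|²/2} e^{-Δ/4} p` from the polynomials to `L²(μ_κ)`. Up to scalars, it takes
`φ_n` to the Hermite function `h_n`. -/
def hermiteLp (hκ : ∀ α ∈ Rp, 0 ≤ κ α) (h2 : ∀ α ∈ Rp, inner ℝ α α = (2 : ℝ)) :
    MvPolynomial (Fin d) ℂ →ₗ[ℂ] Lp ℂ 2 (mu Rp κ) :=
  gaussLp hκ h2 ∘ₗ expPoly Rp κ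

/-- For the inner product induced by `hermiteLp`, multiplication by `x_j` is adjoint to `T_j / 2`. -/
lemma inner_hermiteLp_X_mul (hR : IsRootSystem R) (hRp : IsPositiveSubsystem R Rp)
    (hκ : IsMultiplicity R κ) (hκ0 : ∀ α ∈ Rp, 0 ≤ κ α) (h2 : ∀ α ∈ Rp, inner ℝ α α = (2 : ℝ))
    (j : Fin d) (p q : MvPolynomial (Fin d) ℂ) :
    inner ℂ (hermiteLp hκ0 h2 (X j * p)) (hermiteLp hκ0 h2 q)
      = (1 / 2 : ℂ) * inner ℂ (hermiteLp hκ0 h2 p) (hermiteLp hκ0 h2 (dunklPoly Rp κ j q)) := by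
  simp only [hermiteLp, LinearMap.comp_apply, expPoly_X_mul hR hRp hκ,
    expPoly_dunklPoly hR hRp hκ, map_sub, map_smul, inner_sub_left, inner_smul_left]
  have h1 := inner_gaussLp_dunklPoly hR hRp hκ hκ0 h2 j (expPoly Rp κ p) (expPoly Rp κ q)
  have h3 := inner_gaussLp_X_mul hκ0 h2 j (expPoly Rp κ p) (expPoly Rp κ q)
  simp only [map_div₀, map_one, map_ofNat]
  linear_combination h3 - (1 / 2 : ℂ) * h1

lemma norm_hermiteLp_reflPoly (hR : IsRootSystem R) (hRp : IsPositiveSubsystem R Rp)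
    (hκ : IsMultiplicity R κ) (hκ0 : ∀ α ∈ Rp, 0 ≤ κ α) (h2 : ∀ α ∈ Rp, inner ℝ α α = (2 : ℝ))
    {α : EuclideanSpace ℝ (Fin d)} (hα : α ∈ R) (p : MvPolynomial (Fin d) ℂ) :
    ‖hermiteLp hκ0 h2 (reflPoly α p)‖ = ‖hermiteLp hκ0 h2 p‖ := by
  simp only [hermiteLp, LinearMap.comp_apply, expPoly_reflPoly hR hRp hκ hα,
    norm_gaussLp_reflPoly hR hRp hκ hκ0 h2 hα]

/-! ### The normalizing constant -/

lemma cConst_pos (hRp : IsPositiveSubsystem R Rp) (hκ0 : ∀ α ∈ Rp, 0 ≤ κ α)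
    (h2 : ∀ α ∈ Rp, inner ℝ α α = (2 : ℝ)) : 0 < cConst Rp κ := by
  rw [cConst, integral_mu hκ0]
  have hcont : Continuous fun x : EuclideanSpace ℝ (Fin d) =>
      weight Rp κ x • Real.exp (-‖x‖ ^ 2 / 2) :=
    (continuous_weight hκ0).smul (by fun_prop)
  have hnn : ∀ x : EuclideanSpace ℝ (Fin d), 0 ≤ weight Rp κ x • Real.exp (-‖x‖ ^ 2 / 2) :=
    fun x => smul_nonneg (weight_nonneg x) (Real.exp_pos _).le
  obtain ⟨C, N, hC, hw⟩ := exists_regWeight_le hκ0 h2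
  have hint : Integrable fun x : EuclideanSpace ℝ (Fin d) =>
      weight Rp κ x • Real.exp (-‖x‖ ^ 2 / 2) := by
    refine integrable_of_norm_le (a := 0) (b := 1 / 2) (C := C) (N := N)
      hcont.aestronglyMeasurable hC (by norm_num) fun x => ?_
    rw [Real.norm_of_nonneg (hnn x), smul_eq_mul, ← regWeight_zero]
    refine mul_le_mul (hw 0 le_rfl zero_le_one x) (le_of_eq ?_) (Real.exp_pos _).le (by positivity)
    congr 1
    ring
  rw [integral_pos_iff_support_of_nonneg hnn hint]
  -- the weight does not vanish at a vector orthogonal to no root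
  refine hcont.isOpen_support.measure_pos volume ?_
  obtain ⟨β, hβ, h⟩ := hRp
  refine ⟨β, ?_⟩
  rw [Function.mem_support]
  refine (smul_pos (Finset.prod_pos fun α hα => ?_) (Real.exp_pos _)).ne'
  exact Real.rpow_pos_of_pos (abs_pos.2 (hβ α ((h α).1 hα).1)) _

lemma integral_regDensity_zero (hκ0 : ∀ α ∈ Rp, 0 ≤ κ α) :
    (2 : ℝ) ^ (gam Rp κ + (d : ℝ) / 2) * ∫ x, regDensity Rp κ 0 x = cConst Rp κ := by
  rw [cConst, integral_mu hκ0]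
  have h := Measure.integral_comp_smul volume (fun x : EuclideanSpace ℝ (Fin d) =>
    weight Rp κ x • Real.exp (-‖x‖ ^ 2 / 2)) (√2)
  have hpt : ∀ x : EuclideanSpace ℝ (Fin d),
      weight Rp κ (√2 • x) • Real.exp (-‖√2 • x‖ ^ 2 / 2)
        = (2 : ℝ) ^ gam Rp κ * regDensity Rp κ 0 x := by
    intro x
    have h1 : weight Rp κ (√2 • x) = (2 : ℝ) ^ gam Rp κ * weight Rp κ x := by
      rw [weight, weight, gam, Real.rpow_sum_of_pos two_pos, ← Finset.prod_mul_distrib]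
      refine Finset.prod_congr rfl fun α _ => ?_
      rw [inner_smul_right, abs_mul, Real.mul_rpow (abs_nonneg _) (abs_nonneg _),
        abs_of_nonneg (Real.sqrt_nonneg 2), Real.rpow_mul (Real.sqrt_nonneg 2)]
      norm_num
    have h3 : -‖√2 • x‖ ^ 2 / 2 = -‖x‖ ^ 2 := by
      rw [norm_smul, mul_pow, Real.norm_of_nonneg (Real.sqrt_nonneg 2), Real.sq_sqrt two_pos.le]
      ring
    rw [h1, h3, regDensity, regWeight_zero, smul_eq_mul, mul_assoc]
  simp only [hpt] at h
  rw [integral_const_mul, finrank_euclideanSpace_fin, smul_eq_mul, abs_of_pos (by positivity)] at h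
  have hs : (2 : ℝ) ^ ((d : ℝ) / 2) = √2 ^ d := by
    rw [Real.sqrt_eq_rpow, ← Real.rpow_natCast, ← Real.rpow_mul two_pos.le]
    congr 1
    ring
  rw [Real.rpow_add two_pos, hs, mul_comm _ (√2 ^ d), mul_assoc, h, ← mul_assoc,
    mul_inv_cancel₀ (by positivity), one_mul]

/-- The constant `m_κ` normalizes the Gaussian: `m_κ ∫ e^{-|x|²} dμ_κ = 1`. -/
lemma mConst_mul_integral (hRp : IsPositiveSubsystem R Rp) (hκ0 : ∀ α ∈ Rp, 0 ≤ κ α)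
    (h2 : ∀ α ∈ Rp, inner ℝ α α = (2 : ℝ)) :
    mConst Rp κ * ∫ x, regDensity Rp κ 0 x = 1 := by
  rw [mConst, div_mul_eq_mul_div, integral_regDensity_zero hκ0,
    div_self (cConst_pos hRp hκ0 h2).ne']

lemma inner_hermiteLp_one (hκ0 : ∀ α ∈ Rp, 0 ≤ κ α) (h2 : ∀ α ∈ Rp, inner ℝ α α = (2 : ℝ)) :
    inner ℂ (hermiteLp hκ0 h2 1) (hermiteLp hκ0 h2 1)
      = ((∫ x, regDensity Rp κ 0 x : ℝ) : ℂ) := by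
  have : expPoly Rp κ (1 : MvPolynomial (Fin d) ℂ) = 1 := by rw [← C_1, expPoly_C]
  rw [hermiteLp, LinearMap.comp_apply, this, inner_gaussLp, ← integral_complex_ofReal]
  simp

end Gauss

/-! ### Density of the polynomials times the Gaussian -/

section Density

lemma charFun_withDensity_ofReal {μ : Measure (EuclideanSpace ℝ (Fin d))}
    {h : EuclideanSpace ℝ (Fin d) → ℝ} (hm : AEMeasurable h μ) (h0 : ∀ x, 0 ≤ h x)
    (t : EuclideanSpace ℝ (Fin d)) :
    charFun (μ.withDensity fun x => ENNReal.ofReal (h x)) t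
      = ∫ x, ((h x : ℝ) : ℂ) * Complex.exp (inner ℝ x t * Complex.I) ∂μ := by
  rw [charFun_apply, integral_withDensity_eq_integral_toReal_smul₀ hm.ennreal_ofReal
    (Eventually.of_forall fun x => by simp)]
  simp only [ENNReal.toReal_ofReal (h0 _), Complex.real_smul]

lemma re_ae_eq_zero_of_integral_mul_exp_eq_zero {μ : Measure (EuclideanSpace ℝ (Fin d))}
    {G : EuclideanSpace ℝ (Fin d) → ℂ} (hG : Integrable G μ)
    (h : ∀ t, ∫ x, G x * Complex.exp (inner ℝ x t * Complex.I) ∂μ = 0) :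
    (fun x => (G x).re) =ᵐ[μ] 0 := by
  have hre : Integrable (fun x => (G x).re) μ := hG.re
  have hpos := hre.pos_part
  have hneg := hre.neg_part
  have hexp : ∀ (t : EuclideanSpace ℝ (Fin d)) {f : EuclideanSpace ℝ (Fin d) → ℂ},
      Integrable f μ → Integrable (fun x => f x * Complex.exp (inner ℝ x t * Complex.I)) μ := by
    intro t f hf
    refine hf.mul_bdd (c := 1) (Continuous.aestronglyMeasurable (by fun_prop))
      (Eventually.of_forall fun x => ?_)
    rw [Complex.norm_exp_ofReal_mul_I]
  have hreal : ∀ t, ∫ x, (((G x).re : ℝ) : ℂ) * Complex.exp (inner ℝ x t * Complex.I) ∂μ = 0 := by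
    intro t
    have hpt : ∀ x, (((G x).re : ℝ) : ℂ) * Complex.exp (inner ℝ x t * Complex.I)
        = (1 / 2 : ℂ) * (G x * Complex.exp (inner ℝ x t * Complex.I)
          + (starRingEnd ℂ) (G x * Complex.exp (inner ℝ x (-t) * Complex.I))) := by
      intro x
      rw [Complex.re_eq_add_conj, map_mul, ← Complex.exp_conj]
      simp
      ring
    simp only [hpt]
    have hconj : Integrable (fun x => (starRingEnd ℂ)
        (G x * Complex.exp (inner ℝ x (-t) * Complex.I))) μ :=
      (Complex.conjLIE.integrable_comp_iff).2 (hexp (-t) hG)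
    rw [integral_const_mul, integral_add (hexp t hG) hconj, integral_conj, h, h]
    simp
  -- the positive and negative parts of the real part define finite measures
  -- with the same characteristic function
  have hfin : ∀ f : EuclideanSpace ℝ (Fin d) → ℝ, Integrable f μ →
      IsFiniteMeasure (μ.withDensity fun x => ENNReal.ofReal (f x)) := fun f hf =>
    isFiniteMeasure_withDensity_ofReal hf.2
  have := hfin _ hpos
  have := hfin _ hneg
  have heq : (μ.withDensity fun x => ENNReal.ofReal (max (G x).re 0))
      = μ.withDensity fun x => ENNReal.ofReal (max (-(G x).re) 0) := by
    refine Measure.ext_of_charFun (funext fun t => ?_)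
    have ipos : Integrable (fun x => ((max (G x).re 0 : ℝ) : ℂ)
      * Complex.exp (inner ℝ x t * Complex.I)) μ := hexp t hpos.ofReal
    have ineg : Integrable (fun x => ((max (-(G x).re) 0 : ℝ) : ℂ)
      * Complex.exp (inner ℝ x t * Complex.I)) μ := hexp t hneg.ofReal
    rw [charFun_withDensity_ofReal hpos.aemeasurable fun x => le_max_right _ _,
      charFun_withDensity_ofReal hneg.aemeasurable fun x => le_max_right _ _, ← sub_eq_zero,
      ← integral_sub ipos ineg, ← hreal t]
    congr 1
    ext x
    rw [← sub_mul, ← Complex.ofReal_sub]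
    congr 2
    exact max_zero_sub_max_neg_zero_eq_self _
  have hae := (withDensity_eq_iff hpos.aemeasurable.ennreal_ofReal hneg.aemeasurable.ennreal_ofReal
    (by
      rw [← setLIntegral_univ, ← withDensity_apply _ MeasurableSet.univ]
      exact measure_ne_top _ _)).1 heq
  filter_upwards [hae] with x hx
  rw [ENNReal.ofReal_eq_ofReal_iff (le_max_right _ _) (le_max_right _ _)] at hx
  have := max_zero_sub_max_neg_zero_eq_self (G x).re
  rw [hx, sub_self] at this
  exact this.symm

/-- An integrable function whose Fourier transform vanishes is zero almost everywhere. -/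
lemma ae_eq_zero_of_integral_mul_exp_eq_zero {μ : Measure (EuclideanSpace ℝ (Fin d))}
    {G : EuclideanSpace ℝ (Fin d) → ℂ} (hG : Integrable G μ)
    (h : ∀ t, ∫ x, G x * Complex.exp (inner ℝ x t * Complex.I) ∂μ = 0) : G =ᵐ[μ] 0 := by
  have h1 := re_ae_eq_zero_of_integral_mul_exp_eq_zero hG h
  have h2 := re_ae_eq_zero_of_integral_mul_exp_eq_zero (hG.const_mul Complex.I) fun t => by
    simp only [mul_assoc]
    rw [integral_const_mul, h, mul_zero]
  filter_upwards [h1, h2] with x hx1 hx2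
  refine Complex.ext hx1 ?_
  simpa using hx2

variable {Rp : Finset (EuclideanSpace ℝ (Fin d))} {κ : EuclideanSpace ℝ (Fin d) → ℝ}

lemma memLp_exp_abs_inner (hκ : ∀ α ∈ Rp, 0 ≤ κ α) (h2 : ∀ α ∈ Rp, inner ℝ α α = (2 : ℝ))
    (t : EuclideanSpace ℝ (Fin d)) :
    MemLp (fun x => Real.exp (-‖x‖ ^ 2 / 2) * Real.exp |(inner ℝ x t : ℝ)|) 2 (mu Rp κ) := by
  have hc : Continuous fun x : EuclideanSpace ℝ (Fin d) =>
    Real.exp (-‖x‖ ^ 2 / 2) * Real.exp |(inner ℝ x t : ℝ)| := by fun_prop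
  rw [memLp_two_iff_integrable_sq_norm hc.aestronglyMeasurable, integrable_mu_iff hκ]
  obtain ⟨C, N, hC, hw⟩ := exists_regWeight_le hκ h2
  refine integrable_of_norm_le (a := 2 * ‖t‖) (b := 1) (C := C) (N := N)
    (((continuous_weight hκ).smul (hc.norm.pow 2)).aestronglyMeasurable) hC one_pos fun x => ?_
  rw [Real.norm_of_nonneg (smul_nonneg (weight_nonneg x) (by positivity)), smul_eq_mul,
    ← regWeight_zero, Real.norm_of_nonneg (by positivity), ← Real.exp_add, ← Real.exp_nat_mul]
  refine mul_le_mul (hw 0 le_rfl zero_le_one x) (Real.exp_le_exp.2 ?_) (Real.exp_pos _).le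
    (by positivity)
  have := abs_real_inner_le_norm x t
  push_cast
  linarith

/-- The functions `e^{-|x|²/2} p`, `p` a polynomial, are dense in `L²(μ_κ)`: if `g` is orthogonal to
all of them, then by expanding the exponential into its power series the Fourier transform of
`e^{-|x|²/2} g` vanishes. -/
lemma denseRange_gaussLp (hκ : ∀ α ∈ Rp, 0 ≤ κ α) (h2 : ∀ α ∈ Rp, inner ℝ α α = (2 : ℝ)) :
    DenseRange (gaussLp hκ h2) := by
  have htop : (LinearMap.range (gaussLp hκ h2)).topologicalClosure = ⊤ := by
    rw [Submodule.topologicalClosure_eq_top_iff, Submodule.eq_bot_iff]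
    intro g hg
    rw [Submodule.mem_orthogonal] at hg
    set G : EuclideanSpace ℝ (Fin d) → ℂ :=
      fun x => ((Real.exp (-‖x‖ ^ 2 / 2) : ℝ) : ℂ) * g x with hG
    have hexpm : AEStronglyMeasurable
        (fun x : EuclideanSpace ℝ (Fin d) => ((Real.exp (-‖x‖ ^ 2 / 2) : ℝ) : ℂ)) (mu Rp κ) :=
      Continuous.aestronglyMeasurable (by fun_prop)
    have hGm : AEStronglyMeasurable G (mu Rp κ) := hexpm.mul (Lp.aestronglyMeasurable g)
    have hGexp : ∀ t, Integrable (fun x => ‖G x‖ * Real.exp |(inner ℝ x t : ℝ)|) (mu Rp κ) := by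
      intro t
      refine ((memLp_exp_abs_inner hκ h2 t).integrable_mul (Lp.memLp g).norm).congr
        (Eventually.of_forall fun x => ?_)
      simp only [hG, norm_mul, Complex.norm_real, Real.norm_of_nonneg (Real.exp_pos _).le,
        Pi.mul_apply]
      ring
    have hGint : Integrable G (mu Rp κ) := by
      rw [← integrable_norm_iff hGm]
      simpa using hGexp 0
    have hpoly : ∀ p, ∫ x, G x * polyFun p x ∂(mu Rp κ) = 0 := by
      intro p
      rw [← hg _ ⟨conjPoly p, rfl⟩, L2.inner_def]
      refine integral_congr_ae ?_
      filter_upwards [(memLp_gaussFun hκ h2 (conjPoly p)).coeFn_toLp] with x hx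
      rw [gaussLp_apply, hx]
      simp only [hG, gaussFun, RCLike.inner_apply, polyFun_conjPoly, map_mul, Complex.conj_ofReal,
        Complex.conj_conj]
      ring
    have hzero : G =ᵐ[mu Rp κ] 0 := by
      refine ae_eq_zero_of_integral_mul_exp_eq_zero hGint fun t => ?_
      have hsum := hasSum_integral_of_dominated_convergence (μ := mu Rp κ)
        (F := fun (n : ℕ) x => G x * polyFun (C (Complex.I ^ n / n.factorial) * linForm t ^ n) x)
        (f := fun x => G x * Complex.exp (inner ℝ x t * Complex.I))
        (fun n x => ‖G x‖ * (|(inner ℝ x t : ℝ)| ^ n / n.factorial)) ?_ ?_ ?_ ?_ ?_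
      · simp only [hpoly] at hsum
        exact hsum.unique hasSum_zero
      · exact fun n => hGm.mul (continuous_polyFun _).aestronglyMeasurable
      · refine fun n => Eventually.of_forall fun x => le_of_eq ?_
        simp only [polyFun_mul, polyFun_C, polyFun_pow, polyFun_linForm, norm_mul, norm_div,
          norm_pow, Complex.norm_I, one_pow, Complex.norm_natCast, Complex.norm_real,
          Real.norm_eq_abs]
        ring
      · exact Eventually.of_forall fun x =>
          (Real.summable_pow_div_factorial |(inner ℝ x t : ℝ)|).mul_left _
      · refine (hGexp t).congr (Eventually.of_forall fun x => ?_)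
        simp only [tsum_mul_left]
        rw [Real.exp_eq_exp_ℝ, NormedSpace.exp_eq_tsum_div]
      · refine Eventually.of_forall fun x => HasSum.mul_left _ ?_
        have := NormedSpace.expSeries_div_hasSum_exp (𝔸 := ℂ) (inner ℝ x t * Complex.I)
        rw [← Complex.exp_eq_exp_ℂ] at this
        refine this.congr_fun fun n => ?_
        simp only [polyFun_mul, polyFun_C, polyFun_pow, polyFun_linForm]
        ring
    refine (Lp.eq_zero_iff_ae_eq_zero).2 ?_
    filter_upwards [hzero] with x hx
    simpa [hG] using hx
  have := (Submodule.dense_iff_topologicalClosure_eq_top).2 htop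
  rwa [LinearMap.coe_range] at this

lemma denseRange_hermiteLp (hκ : ∀ α ∈ Rp, 0 ≤ κ α) (h2 : ∀ α ∈ Rp, inner ℝ α α = (2 : ℝ)) :
    DenseRange (hermiteLp hκ h2) := by
  have := denseRange_gaussLp hκ h2
  rwa [DenseRange, ← (expPoly_surjective (Rp := Rp) (κ := κ)).range_comp] at this

end Density

/-! ### Hermite functions and Riesz transforms -/

section Hermite

variable {R Rp : Finset (EuclideanSpace ℝ (Fin d))} {κ : EuclideanSpace ℝ (Fin d) → ℝ}
  {φ : (Fin d → ℕ) → MvPolynomial (Fin d) ℂ}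

lemma fderiv_gaussFun (p : MvPolynomial (Fin d) ℂ) (x v : EuclideanSpace ℝ (Fin d)) :
    fderiv ℝ (gaussFun p) x v = ((Real.exp (-‖x‖ ^ 2 / 2) : ℝ) : ℂ)
      * (fderiv ℝ (polyFun p) x v - ((inner ℝ x v : ℝ) : ℂ) * polyFun p x) := by
  have h1 : HasFDerivAt (fun y : EuclideanSpace ℝ (Fin d) => Real.exp (-‖y‖ ^ 2 / 2))
      (Real.exp (-‖x‖ ^ 2 / 2) • -(innerSL ℝ x)) x := by
    have h := ((hasStrictFDerivAt_norm_sq x).hasFDerivAt.neg.mul_const (1 / 2 : ℝ)).exp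
    have e : (fun y : EuclideanSpace ℝ (Fin d) => Real.exp (-‖y‖ ^ 2 / 2))
        = fun y => Real.exp (-‖y‖ ^ 2 * (1 / 2)) := by ext y; ring_nf
    rw [e]
    refine h.congr_fderiv ?_
    ext w
    simp only [Pi.neg_apply, smul_apply, neg_apply, smul_eq_mul, innerSL_apply_apply,
      mul_neg, neg_mul, nsmul_eq_mul]
    ring_nf
  have h2 := (Complex.ofRealCLM.hasFDerivAt.comp x h1).mul (hasFDerivAt_polyFun p x)
  have h3 : gaussFun p = (Complex.ofRealCLM ∘ fun y : EuclideanSpace ℝ (Fin d) =>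
    Real.exp (-‖y‖ ^ 2 / 2)) * polyFun p := by ext y; simp [gaussFun]
  rw [h3, h2.fderiv, ← (hasFDerivAt_polyFun p x).fderiv]
  simp
  ring

lemma diffQuot_gaussFun {α : EuclideanSpace ℝ (Fin d)} (h : inner ℝ α α = (2 : ℝ))
    (p : MvPolynomial (Fin d) ℂ) (x : EuclideanSpace ℝ (Fin d)) :
    diffQuot α (gaussFun p) x
      = ((Real.exp (-‖x‖ ^ 2 / 2) : ℝ) : ℂ) * diffQuot α (polyFun p) x := by
  unfold diffQuot
  split_ifs with h0
  · rw [fderiv_gaussFun, h0]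
    simp
  · simp only [gaussFun, norm_rootReflection h]
    ring

/-- Conjugation by the Gaussian turns `δ_j = T_j + x_j` into `T_j`. -/
lemma delta_gaussFun (h2 : ∀ α ∈ Rp, inner ℝ α α = (2 : ℝ)) (j : Fin d)
    (p : MvPolynomial (Fin d) ℂ) :
    delta Rp κ j (gaussFun p) = gaussFun (dunklPoly Rp κ j p) := by
  ext x
  have hs : ∑ α ∈ Rp, ((κ α * α j : ℝ) : ℂ) * diffQuot α (gaussFun p) x
      = ((Real.exp (-‖x‖ ^ 2 / 2) : ℝ) : ℂ)
        * ∑ α ∈ Rp, ((κ α * α j : ℝ) : ℂ) * diffQuot α (polyFun p) x := by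
    rw [Finset.mul_sum]
    exact Finset.sum_congr rfl fun α hα => by rw [diffQuot_gaussFun (h2 α hα)]; ring
  rw [delta, dunklT, hs, fderiv_gaussFun, EuclideanSpace.inner_single_right, gaussFun, gaussFun,
    polyFun_dunklPoly, dunklT]
  simp
  ring

variable (Rp κ φ) in
/-- The polynomial `2^{|n|/2} √m_κ φ_n`, which corresponds to the Hermite function `h_n`. -/
def hermiteSymbol (n : Fin d → ℕ) : MvPolynomial (Fin d) ℂ :=
  (((2 : ℝ) ^ (-((∑ i, n i : ℕ) : ℝ) / 2) * √(mConst Rp κ) * 2 ^ (∑ i, n i) : ℝ) : ℂ) • φ n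

lemma hermiteFun_eq (n : Fin d → ℕ) :
    hermiteFun Rp κ φ n = gaussFun (expPoly Rp κ (hermiteSymbol Rp κ φ n)) := by
  ext x
  rw [hermiteFun, hermiteH, hermiteSymbol, map_smul, gaussFun, polyFun_smul, polyFun_expPoly]
  push_cast
  ring

lemma mConst_pos (hRp : IsPositiveSubsystem R Rp) (hκ0 : ∀ α ∈ Rp, 0 ≤ κ α)
    (h2 : ∀ α ∈ Rp, inner ℝ α α = (2 : ℝ)) : 0 < mConst Rp κ :=
  div_pos (by positivity) (cConst_pos hRp hκ0 h2)

lemma isHomogeneous_hermiteSymbol (hφ : IsOrthonormalBasis Rp κ φ) (n : Fin d → ℕ) :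
    (hermiteSymbol Rp κ φ n).IsHomogeneous (∑ i, n i) := by
  rw [hermiteSymbol, smul_eq_C_mul]
  exact (hφ.homogeneous n).C_mul _

lemma span_hermiteSymbol (hRp : IsPositiveSubsystem R Rp) (hκ0 : ∀ α ∈ Rp, 0 ≤ κ α)
    (h2 : ∀ α ∈ Rp, inner ℝ α α = (2 : ℝ)) (hφ : IsOrthonormalBasis Rp κ φ) :
    Submodule.span ℂ (Set.range (hermiteSymbol Rp κ φ)) = ⊤ := by
  rw [eq_top_iff, ← hφ.span_eq_top, Submodule.span_le]
  rintro _ ⟨n, rfl⟩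
  set c : ℂ := (((2 : ℝ) ^ (-((∑ i, n i : ℕ) : ℝ) / 2) * √(mConst Rp κ) * 2 ^ (∑ i, n i) : ℝ) : ℂ)
    with hc
  have hc0 : c ≠ 0 := by
    have := Real.sqrt_pos.2 (mConst_pos hRp hκ0 h2)
    rw [hc, Complex.ofReal_ne_zero]
    positivity
  have : φ n = c⁻¹ • hermiteSymbol Rp κ φ n := by
    rw [hermiteSymbol, smul_smul, inv_mul_cancel₀ hc0, one_smul]
  rw [this]
  exact Submodule.smul_mem _ _ (Submodule.subset_span ⟨n, rfl⟩)

/-- The Hermite functions are orthonormal in `L²(μ_κ)`. -/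
lemma orthonormal_hermiteLp (hR : IsRootSystem R) (hRp : IsPositiveSubsystem R Rp)
    (hκ : IsMultiplicity R κ) (hκ0 : ∀ α ∈ Rp, 0 ≤ κ α) (h2 : ∀ α ∈ Rp, inner ℝ α α = (2 : ℝ))
    (hφ : IsOrthonormalBasis Rp κ φ) :
    Orthonormal ℂ fun n => hermiteLp hκ0 h2 (hermiteSymbol Rp κ φ n) := by
  classical
  have hle : ∀ n m : Fin d → ℕ, ∑ i, m i ≤ ∑ i, n i →
      inner ℂ (hermiteLp hκ0 h2 (φ n)) (hermiteLp hκ0 h2 (φ m))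
        = (1 / 2 : ℂ) ^ (∑ i, n i) * (if n = m then 1 else 0)
          * ((∫ x, regDensity Rp κ 0 x : ℝ) : ℂ) := fun n m h => by
    rw [inner_eq_pairing (hermiteLp hκ0 h2) (inner_hermiteLp_X_mul hR hRp hκ hκ0 h2)
      (hφ.homogeneous n) (hφ.homogeneous m) h (hφ.real_coeff n), hφ.orthonormal,
      inner_hermiteLp_one]
  rw [orthonormal_iff_ite]
  intro n m
  simp only [hermiteSymbol, map_smul, inner_smul_left, inner_smul_right, Complex.conj_ofReal]
  by_cases hnm : n = m
  · subst hnm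
    simp only [hle n n le_rfl, if_true, mul_one]
    have hm := mConst_mul_integral hRp hκ0 h2
    have hsq : √(mConst Rp κ) * √(mConst Rp κ) = mConst Rp κ :=
      Real.mul_self_sqrt (mConst_pos hRp hκ0 h2).le
    set k := ∑ i, n i with hk
    have hpow : (2 : ℝ) ^ (-(k : ℝ) / 2) * (2 : ℝ) ^ (-(k : ℝ) / 2) * 2 ^ k = 1 := by
      rw [← Real.rpow_add two_pos, ← Real.rpow_natCast, ← Real.rpow_add two_pos]
      ring_nf
      exact Real.rpow_zero 2
    have hhalf : (2 : ℝ) ^ k * (1 / 2 : ℝ) ^ k = 1 := by rw [← mul_pow]; norm_num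
    have : ((2 : ℝ) ^ (-(k : ℝ) / 2) * √(mConst Rp κ) * 2 ^ k)
        * (((2 : ℝ) ^ (-(k : ℝ) / 2) * √(mConst Rp κ) * 2 ^ k)
          * ((1 / 2 : ℝ) ^ k * ∫ x, regDensity Rp κ 0 x)) = 1 := by
      calc _ = ((2 : ℝ) ^ (-(k : ℝ) / 2) * (2 : ℝ) ^ (-(k : ℝ) / 2) * 2 ^ k)
            * ((2 : ℝ) ^ k * (1 / 2 : ℝ) ^ k)
            * ((√(mConst Rp κ) * √(mConst Rp κ)) * ∫ x, regDensity Rp κ 0 x) := by ring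
        _ = 1 := by rw [hpow, hhalf, hsq, hm, one_mul, one_mul]
    have hC := congrArg Complex.ofReal this
    rw [Complex.ofReal_one, Complex.ofReal_mul, Complex.ofReal_mul _ ((1 / 2) ^ k * _),
      Complex.ofReal_mul ((1 / 2) ^ k), Complex.ofReal_pow] at hC
    simpa using hC
  · rw [if_neg hnm]
    rcases le_total (∑ i, m i) (∑ i, n i) with h | h
    · rw [hle n m h, if_neg hnm]
      ring
    · rw [← inner_conj_symm, hle m n h, if_neg (Ne.symm hnm)]
      simp

lemma hermiteCoeff_gaussFun (hκ0 : ∀ α ∈ Rp, 0 ≤ κ α) (h2 : ∀ α ∈ Rp, inner ℝ α α = (2 : ℝ))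
    (p : MvPolynomial (Fin d) ℂ) (n : Fin d → ℕ) :
    hermiteCoeff Rp κ φ (gaussFun (expPoly Rp κ p)) n
      = inner ℂ (hermiteLp hκ0 h2 (hermiteSymbol Rp κ φ n)) (hermiteLp hκ0 h2 p) := by
  rw [hermiteCoeff, hermiteFun_eq, hermiteLp, LinearMap.comp_apply, LinearMap.comp_apply,
    inner_gaussLp_eq_integral_mu]

lemma gaussFun_sum {ι : Type*} (s : Finset ι) (a : ι → ℂ) (p : ι → MvPolynomial (Fin d) ℂ) :
    gaussFun (∑ n ∈ s, a n • p n) = ∑ n ∈ s, a n • gaussFun (p n) := by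
  ext x
  simp only [gaussFun, polyFun_sum, polyFun_smul, Finset.sum_apply, Pi.smul_apply, smul_eq_mul,
    Finset.mul_sum, mul_left_comm]

/-- The elements of the span of the Hermite functions. -/
lemma mem_hermiteSpan_iff (f : EuclideanSpace ℝ (Fin d) → ℂ) : f ∈ hermiteSpan Rp κ φ ↔
    ∃ a : (Fin d → ℕ) →₀ ℂ, f
      = gaussFun (expPoly Rp κ (Finsupp.linearCombination ℂ (hermiteSymbol Rp κ φ) a)) := by
  rw [hermiteSpan, Finsupp.mem_span_range_iff_exists_finsupp]
  refine exists_congr fun a => ?_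
  simp only [Finsupp.linearCombination_apply, Finsupp.sum, map_sum, map_smul, gaussFun_sum,
    hermiteFun_eq]
  exact eq_comm

variable (Rp κ) in
/-- The factor `(2|n| + 2γ_κ + d)^{-1/2}`. -/
def rieszFactor (n : Fin d → ℕ) : ℝ :=
  (2 * ((∑ i, n i : ℕ) : ℝ) + 2 * gam Rp κ + (d : ℝ)) ^ (-(1 / 2) : ℝ)

lemma hermiteCoeff_linearCombination (hR : IsRootSystem R) (hRp : IsPositiveSubsystem R Rp)
    (hκ : IsMultiplicity R κ) (hφ : IsOrthonormalBasis Rp κ φ) (a : (Fin d → ℕ) →₀ ℂ)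
    (n : Fin d → ℕ) : hermiteCoeff Rp κ φ
      (gaussFun (expPoly Rp κ (Finsupp.linearCombination ℂ (hermiteSymbol Rp κ φ) a))) n = a n := by
  have hκ0 : ∀ α ∈ Rp, 0 ≤ κ α := fun α hα => hκ.nonneg α (hRp.subset hα)
  have h2 : ∀ α ∈ Rp, inner ℝ α α = (2 : ℝ) := fun α hα => hR.inner_self α (hRp.subset hα)
  rw [hermiteCoeff_gaussFun hκ0 h2, Finsupp.apply_linearCombination]
  exact (orthonormal_hermiteLp hR hRp hκ hκ0 h2 hφ).inner_right_finsupp a n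

lemma riesz_linearCombination (hR : IsRootSystem R) (hRp : IsPositiveSubsystem R Rp)
    (hκ : IsMultiplicity R κ) (hφ : IsOrthonormalBasis Rp κ φ) (j : Fin d)
    (a : (Fin d → ℕ) →₀ ℂ) : riesz Rp κ φ j
      (gaussFun (expPoly Rp κ (Finsupp.linearCombination ℂ (hermiteSymbol Rp κ φ) a)))
      = gaussFun (expPoly Rp κ (dunklPoly Rp κ j
        (∑ n ∈ a.support, ((rieszFactor Rp κ n : ℂ) * a n) • hermiteSymbol Rp κ φ n))) := by
  have h2 : ∀ α ∈ Rp, inner ℝ α α = (2 : ℝ) := fun α hα => hR.inner_self α (hRp.subset hα)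
  ext x
  rw [riesz, finsum_eq_sum_of_support_subset (s := a.support)]
  · simp only [map_sum, map_smul, gaussFun_sum, Finset.sum_apply, Pi.smul_apply, smul_eq_mul]
    refine Finset.sum_congr rfl fun n _ => ?_
    rw [hermiteCoeff_linearCombination hR hRp hκ hφ, hermiteFun_eq, delta_gaussFun h2,
      expPoly_dunklPoly hR hRp hκ, rieszFactor]
  · intro n hn
    rw [Function.mem_support, hermiteCoeff_linearCombination hR hRp hκ hφ] at hn
    rw [Finset.mem_coe, Finsupp.mem_support_iff]
    exact right_ne_zero_of_mul (left_ne_zero_of_mul hn)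

/-- The eigenvalue `2|n| + 2γ_κ + d` dominates half of the bound of `norm_dunklPoly_sq_le`. -/
lemma mul_rieszFactor_sq_le (hκ0 : ∀ α ∈ Rp, 0 ≤ κ α) (hd : 0 < d) (n : Fin d → ℕ) :
    (2 * ((∑ i, n i : ℕ) : ℝ) + 4 * gam Rp κ) * rieszFactor Rp κ n ^ 2 ≤ 2 := by
  have hγ : 0 ≤ gam Rp κ := Finset.sum_nonneg hκ0
  have hd' : (0 : ℝ) < d := by exact_mod_cast hd
  have hn : (0 : ℝ) ≤ ((∑ i, n i : ℕ) : ℝ) := Nat.cast_nonneg _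
  have hpos : 0 < 2 * ((∑ i, n i : ℕ) : ℝ) + 2 * gam Rp κ + (d : ℝ) := by linarith
  have hsq : rieszFactor Rp κ n ^ 2 = (2 * ((∑ i, n i : ℕ) : ℝ) + 2 * gam Rp κ + (d : ℝ))⁻¹ := by
    rw [rieszFactor, ← Real.rpow_natCast, ← Real.rpow_mul hpos.le]
    norm_num [Real.rpow_neg_one]
  rw [hsq, ← div_eq_mul_inv, div_le_iff₀ hpos]
  linarith

/-- The a priori bound for the Riesz transforms on the span of the Hermite functions. -/
lemma norm_riesz_le (hR : IsRootSystem R) (hRp : IsPositiveSubsystem R Rp)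
    (hκ : IsMultiplicity R κ) (hκ0 : ∀ α ∈ Rp, 0 ≤ κ α) (h2 : ∀ α ∈ Rp, inner ℝ α α = (2 : ℝ))
    (hφ : IsOrthonormalBasis Rp κ φ) (j : Fin d) (a : (Fin d → ℕ) →₀ ℂ) :
    ‖hermiteLp hκ0 h2 (dunklPoly Rp κ j
        (∑ n ∈ a.support, ((rieszFactor Rp κ n : ℂ) * a n) • hermiteSymbol Rp κ φ n))‖
      ≤ √2 * ‖hermiteLp hκ0 h2 (Finsupp.linearCombination ℂ (hermiteSymbol Rp κ φ) a)‖ := by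
  have hon := orthonormal_hermiteLp hR hRp hκ hκ0 h2 hφ
  have hnorm : ‖hermiteLp hκ0 h2 (Finsupp.linearCombination ℂ (hermiteSymbol Rp κ φ) a)‖ ^ 2
      = ∑ n ∈ a.support, ‖a n‖ ^ 2 := by
    rw [Finsupp.linearCombination_apply, Finsupp.sum, map_sum]
    simp only [map_smul]
    rw [← inner_self_eq_norm_sq (𝕜 := ℂ), hon.inner_sum, map_sum]
    refine Finset.sum_congr rfl fun n _ => ?_
    rw [mul_comm, RCLike.mul_conj]
    norm_cast
  refine abs_le_of_sq_le_sq' ?_ (by positivity) |>.2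
  rw [mul_pow, Real.sq_sqrt two_pos.le, hnorm, Finset.mul_sum]
  refine (norm_dunklPoly_sq_le (hermiteLp hκ0 h2) (inner_hermiteLp_X_mul hR hRp hκ hκ0 h2)
    (fun α hα => norm_hermiteLp_reflPoly hR hRp hκ hκ0 h2 (hRp.subset hα)) hκ0
    (isHomogeneous_hermiteSymbol hφ) hon a.support _ j).trans (Finset.sum_le_sum fun n _ => ?_)
  rw [norm_mul, mul_pow, Complex.norm_real, Real.norm_eq_abs, sq_abs, ← mul_assoc]
  exact mul_le_mul_of_nonneg_right (mul_rieszFactor_sq_le hκ0 (Fin.pos j) n) (sq_nonneg _)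

end Hermite

end Dunkl

end

theorem mainTheorem5 {d : ℕ}
    (R Rp : Finset (EuclideanSpace ℝ (Fin d))) (κ : EuclideanSpace ℝ (Fin d) → ℝ)
    (hR : Dunkl.IsRootSystem R) (hRp : Dunkl.IsPositiveSubsystem R Rp)
    (hκ : Dunkl.IsMultiplicity R κ)
    (φ : (Fin d → ℕ) → MvPolynomial (Fin d) ℂ) (hφ : Dunkl.IsOrthonormalBasis Rp κ φ)
    (j : Fin d) :
    -- the sum that defines the Riesz transform on the span of the Hermite functions is finite
    (∀ f ∈ Dunkl.hermiteSpan Rp κ φ, {n | Dunkl.hermiteCoeff Rp κ φ f n ≠ 0}.Finite) ∧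
    -- the span and its image under the Riesz transform lie in the space of square integrable functions
    ∃ (hD : ∀ f ∈ Dunkl.hermiteSpan Rp κ φ, MemLp f 2 (Dunkl.mu Rp κ))
      (hRD : ∀ f ∈ Dunkl.hermiteSpan Rp κ φ, MemLp (Dunkl.riesz Rp κ φ j f) 2 (Dunkl.mu Rp κ)),
      -- the Riesz transform has one and only one bounded extension, of norm at most `√2`
      ∃ T : Lp ℂ 2 (Dunkl.mu Rp κ) →L[ℂ] Lp ℂ 2 (Dunkl.mu Rp κ),
        (∀ f (hf : f ∈ Dunkl.hermiteSpan Rp κ φ), T (hD f hf).toLp = (hRD f hf).toLp) ∧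
        ‖T‖ ≤ Real.sqrt 2 ∧
        ∀ T' : Lp ℂ 2 (Dunkl.mu Rp κ) →L[ℂ] Lp ℂ 2 (Dunkl.mu Rp κ),
          (∀ f (hf : f ∈ Dunkl.hermiteSpan Rp κ φ), T' (hD f hf).toLp = (hRD f hf).toLp) →
            T' = T := by
  open Dunkl in
  have hκ0 : ∀ α ∈ Rp, 0 ≤ κ α := fun α hα => hκ.nonneg α (hRp.subset hα)
  have h2 : ∀ α ∈ Rp, inner ℝ α α = (2 : ℝ) := fun α hα => hR.inner_self α (hRp.subset hα)
  have hD : ∀ f ∈ hermiteSpan Rp κ φ, MemLp f 2 (mu Rp κ) := fun f hf => by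
    obtain ⟨a, rfl⟩ := (mem_hermiteSpan_iff f).1 hf
    exact memLp_gaussFun hκ0 h2 _
  have hRD : ∀ f ∈ hermiteSpan Rp κ φ, MemLp (riesz Rp κ φ j f) 2 (mu Rp κ) := fun f hf => by
    obtain ⟨a, rfl⟩ := (mem_hermiteSpan_iff f).1 hf
    rw [riesz_linearCombination hR hRp hκ hφ]
    exact memLp_gaussFun hκ0 h2 _
  refine ⟨fun f hf => ?_, hD, hRD, ?_⟩
  · obtain ⟨a, rfl⟩ := (mem_hermiteSpan_iff f).1 hf
    simp only [hermiteCoeff_linearCombination hR hRp hκ hφ]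
    exact a.hasFiniteSupport
  -- the maps from coefficient sequences to `f` and to its Riesz transform
  let F : ((Fin d → ℕ) →₀ ℂ) →ₗ[ℂ] Lp ℂ 2 (mu Rp κ) :=
    hermiteLp hκ0 h2 ∘ₗ Finsupp.linearCombination ℂ (hermiteSymbol Rp κ φ)
  let G : ((Fin d → ℕ) →₀ ℂ) →ₗ[ℂ] Lp ℂ 2 (mu Rp κ) :=
    (hermiteLp hκ0 h2 ∘ₗ dunklPoly Rp κ j) ∘ₗ
      Finsupp.linearCombination ℂ (fun n => (rieszFactor Rp κ n : ℂ) • hermiteSymbol Rp κ φ n)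
  have hG : ∀ a, G a = hermiteLp hκ0 h2 (dunklPoly Rp κ j
      (∑ n ∈ a.support, ((rieszFactor Rp κ n : ℂ) * a n) • hermiteSymbol Rp κ φ n)) := fun a => by
    simp only [G, LinearMap.comp_apply, Finsupp.linearCombination_apply, Finsupp.sum, smul_smul,
      mul_comm (a _)]
  have hdense : DenseRange F := by
    have hsurj : Function.Surjective (Finsupp.linearCombination ℂ (hermiteSymbol Rp κ φ)) := by
      rw [← LinearMap.range_eq_top, Finsupp.range_linearCombination,
        span_hermiteSymbol hRp hκ0 h2 hφ]
    have := denseRange_hermiteLp hκ0 h2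
    rwa [DenseRange, ← hsurj.range_comp] at this
  have hbound : ∀ a, ‖G a‖ ≤ √2 * ‖F a‖ := fun a => by
    rw [hG]
    exact norm_riesz_le hR hRp hκ hκ0 h2 hφ j a
  have hFmem : ∀ a : (Fin d → ℕ) →₀ ℂ, gaussFun (expPoly Rp κ (Finsupp.linearCombination ℂ
      (hermiteSymbol Rp κ φ) a)) ∈ hermiteSpan Rp κ φ := fun a => (mem_hermiteSpan_iff _).2 ⟨a, rfl⟩
  have hGL : ∀ a, (hRD _ (hFmem a)).toLp = G a := fun a => by
    rw [hG]
    simp only [hermiteLp, LinearMap.comp_apply, gaussLp_apply,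
      riesz_linearCombination hR hRp hκ hφ]
  refine ⟨G.extendOfNorm F, fun f hf => ?_,
    LinearMap.opNorm_extendOfNorm_le hdense (Real.sqrt_nonneg 2) hbound, fun T' hT' => ?_⟩
  · obtain ⟨a, rfl⟩ := (mem_hermiteSpan_iff f).1 hf
    rw [hGL]
    exact LinearMap.extendOfNorm_eq hdense ⟨_, hbound⟩ a
  · refine (LinearMap.extendOfNorm_unique hdense _ hbound T' (LinearMap.ext fun a => ?_)).symm
    exact (hT' _ (hFmem a)).trans (hGL a)
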